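/- Let $K$ be an algebraically closed field of characteristic zero (for instance $K=\mathbb{C}$). Let $n\ge 3$ and let $a,b,c\in K[s,v]$ be homogeneous polynomials of degree $n$ with $\gcd(a,b,c)=1$ such that the map $\phi:\mathbb{P}^1\to\mathbb{P}^2$, $(s:v)\mapsto(a(s,v):b(s,v):c(s,v))$, is birational onto its image. Let $p=(p_1,p_2,p_3)$, $q=(q_1,q_2,q_3)$ be a $\mu$-basis of $\phi$, that is, a basis of the $K[s,v]$-module of syzygies of $(a,b,c)$ whose entries are homogeneous of degree $\mu$ (for $p$) and $n-\mu$ (for $q$), with $\mu\le n-\mu$. Put $$p_\phi=p_1(s,v)a(t,u)+p_2(s,v)b(t,u)+p_3(s,v)c(t,u),\qquad q_\phi=q_1(s,v)a(t,u)+q_2(s,v)b(t,u)+q_3(s,v)c(t,u),$$ and let $S$ be the $n\times n$ Sylvester matrix, with entries in $K[t,u]$, of $p_\phi$ and $q_\phi$ regarded as forms of degrees $\mu$ and $n-\mu$ in $(s,v)$. Let $d_1,\dots,d_n\in K[t,u]$ be singular factors of $\phi$, that is, homogeneous polynomials such that for every $i=1,\dots,n$ the product $d_n^{\,n-i+1}d_{n-1}^{\,n-i}\cdots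 d_{i+1}^{\,2}d_i$ is a greatest common divisor of the $(n+1-i)$-minors of $S$. Let $F=a(s,v)c(t,u)-a(t,u)c(s,v)$ and $G=b(s,v)c(t,u)-b(t,u)c(s,v)$. Then $su-tv$ divides $F$ and $G$ in $K[t,u][s,v]$, and there is a nonzero constant $\gamma\in K$ such that $$\mathrm{Res}_{(s,v)}\left(\frac{F}{su-tv},\frac{G}{su-tv}\right)=\gamma\; c(t,u)^{n-1}\, d_n(t,u)^{n-1}\, d_{n-1}(t,u)^{n-2}\cdots d_3(t,u)^{2}\, d_2(t,u),$$ where $\mathrm{Res}_{(s,v)}$ is the Sylvester resultant of two forms of degree $n-1$ in $(s,v)$ with coefficients in $K[t,u]$. -/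

import Mathlib

open MvPolynomial

noncomputable section

namespace DResultant

/-- The ring `K[t, u]` (with `t = X 0`, `u = X 1`). The same ring, with its variables read as
`s = X 0`, `v = X 1`, holds the forms `a, b, c` and the entries of a `μ`-basis. -/
abbrev Forms (K : Type*) [CommSemiring K] : Type _ := MvPolynomial (Fin 2) K

/-- The ring `K[t, u][s, v]`, with outer variables `s = X 0`, `v = X 1`, and with
`t = C (X 0)`, `u = C (X 1)`. -/
abbrev BiForms (K : Type*) [CommSemiring K] : Type _ := MvPolynomial (Fin 2) (Forms K)

variable {K : Type*} [Field K]

/-- `f(s, v)`, as an element of `K[t, u][s, v]`. -/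
def inSV (f : Forms K) : BiForms K := map (C : K →+* Forms K) f

/-- `f(t, u)`, as an element of `K[t, u][s, v]`. -/
def inTU (f : Forms K) : BiForms K := C f

/-- The form `s u - t v`. -/
def diagForm (K : Type*) [Field K] : BiForms K :=
  inSV (X 0) * inTU (X 1) - inTU (X 0) * inSV (X 1)

/-- `a(s,v) c(t,u) - a(t,u) c(s,v)`. -/
def crossForm (a c : Forms K) : BiForms K := inSV a * inTU c - inTU a * inSV c

/-- Setting `s = X`, `v = 1` in a form in `s, v`: a form `∑ rᵢ sⁱ v^(m-i)` of degree `m`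
becomes `∑ rᵢ Xⁱ`. -/
def dehomog {R : Type*} [CommRing R] (f : MvPolynomial (Fin 2) R) : Polynomial R :=
  aeval ![(Polynomial.X : Polynomial R), 1] f

/-- The Sylvester matrix, with respect to the homogeneous variables `(s, v)`, of two forms of
degrees `m` and `n`: the coefficients, in the monomials `sⁱ v^(m+n-1-i)`, of the products of the
first form with the `n` monomials of degree `n - 1` and of the second form with the `m` monomials
of degree `m - 1`. -/
def formSylvester {R : Type*} [CommRing R] (f g : MvPolynomial (Fin 2) R) (m n : ℕ) :
    Matrix (Fin (m + n)) (Fin (m + n)) R :=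
  Polynomial.sylvester (dehomog f) (dehomog g) m n

/-- The Sylvester resultant, eliminating `(s, v)`, of two forms of degrees `m` and `n`. -/
def formResultant {R : Type*} [CommRing R] (f g : MvPolynomial (Fin 2) R) (m n : ℕ) : R :=
  (formSylvester f g m n).det

/-- The map `(s : v) ↦ (a : b : c)` given by three forms of the same degree is birational onto its
image: there is a rational map `(x₁ : x₂ : x₃) ↦ (g : h)`, given by forms `g, h` of the same degree
which do not both vanish identically on the image, such that
`(g(a,b,c) : h(a,b,c)) = (s : v)`. -/
def IsBirationalOntoImage (a b c : Forms K) : Prop :=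
  ∃ (e : ℕ) (g h : MvPolynomial (Fin 3) K), g.IsHomogeneous e ∧ h.IsHomogeneous e ∧
    ¬ (aeval ![a, b, c] g = 0 ∧ aeval ![a, b, c] h = 0) ∧
    X 1 * aeval ![a, b, c] g = X 0 * aeval ![a, b, c] h

/-- `(a, b, c)` are forms of degree `n` without common factor, which parameterize a plane curve
birationally. -/
structure IsProperParam (n : ℕ) (a b c : Forms K) : Prop where
  homogeneous_a : a.IsHomogeneous n
  homogeneous_b : b.IsHomogeneous n
  homogeneous_c : c.IsHomogeneous n
  coprime : ∀ h : Forms K, h ∣ a → h ∣ b → h ∣ c → IsUnit h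
  birational : IsBirationalOntoImage a b c

/-- The module of syzygies of `(a, b, c)`. -/
def syzygies (a b c : Forms K) : Submodule (Forms K) (Fin 3 → Forms K) :=
  LinearMap.ker (Fintype.linearCombination (Forms K) ![a, b, c])

/-- `(p, q)` is a `μ`-basis of `(a, b, c)` (forms of degree `n`): a basis of the syzygy module,
whose members have degrees `μ ≤ n - μ`. -/
structure IsMuBasis (n μ : ℕ) (a b c : Forms K) (p q : Fin 3 → Forms K) : Prop where
  two_mul_le : 2 * μ ≤ n
  homogeneous_p : ∀ i, (p i).IsHomogeneous μ
  homogeneous_q : ∀ i, (q i).IsHomogeneous (n - μ)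
  linearIndependent : LinearIndependent (Forms K) ![p, q]
  span_eq : Submodule.span (Forms K) {p, q} = syzygies a b c

/-- `p₁(s,v) a(t,u) + p₂(s,v) b(t,u) + p₃(s,v) c(t,u)`. -/
def substForm (a b c : Forms K) (p : Fin 3 → Forms K) : BiForms K :=
  inSV (p 0) * inTU a + inSV (p 1) * inTU b + inSV (p 2) * inTU c

/-- `g` is a greatest common divisor of the `k`-minors of the matrix `A`. -/
def IsGCDOfMinors {R ι : Type*} [CommRing R] (A : Matrix ι ι R) (k : ℕ) (g : R) : Prop :=
  (∀ r c : Fin k ↪ ι, g ∣ (A.submatrix r c).det) ∧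
  ∀ h : R, (∀ r c : Fin k ↪ ι, h ∣ (A.submatrix r c).det) → h ∣ g

/-- `d 1, …, d n` is a collection of singular factors of the parameterization `(a, b, c)` of
degree `n`, computed from its `μ`-basis `(p, q)`: they are homogeneous, and for `i = 1, …, n` the
product `d n ^ (n-i+1) * d (n-1) ^ (n-i) * ⋯ * d (i+1) ^ 2 * d i` is the greatest common divisor of
the `(n+1-i)`-minors of the Sylvester matrix of `p_φ` and `q_φ`. -/
structure IsSingularFactors (n μ : ℕ) (a b c : Forms K) (p q : Fin 3 → Forms K)
    (d : ℕ → Forms K) : Prop where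
  homogeneous : ∀ i ∈ Finset.Icc 1 n, ∃ e : ℕ, (d i).IsHomogeneous e
  isGCD : ∀ i ∈ Finset.Icc 1 n,
    IsGCDOfMinors (formSylvester (substForm a b c p) (substForm a b c q) μ (n - μ)) (n + 1 - i)
      (∏ j ∈ Finset.Icc i n, d j ^ (j - i + 1))

end DResultant

end

open MvPolynomial

noncomputable section

namespace DResultant

/-! ### Evaluation of binary forms and dehomogenization. -/

section General

variable {R S : Type*} [CommRing R] [CommRing S]

/-! Write l = su - tv. It divides both cross forms and, because p and q are syzygies, also p_φ = l P
and q_φ = l Q. The theorem splits into two statements up to units: Res(P, Q) is the gcd of the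
(n-1)-minors of S, which is the product of the d's; and Res(F/l, G/l) = c(t,u)^(n-1) Res(P, Q).

For the first (`associated_resultant_of_isGCDOfMinors`), S is the product of the matrix of
multiplication by l and an (n-1) × n matrix built from P and Q. The maximal minors of the latter
are, up to a common unit and signs, Res(P, Q) times the coefficients of P and Q; two minors of the
former are powers of t and u. Both families have trivial gcd.

For the second (`associated_resultant_of_relations`), let f, g be the quotients of the cross forms.
The syzygies give c P = -(p₁ f + p₂ g) and, since (a, b, c) is proportional to p × q
(`exists_cross_eq`), γ f = p₂ Q - q₂ P. Multiplicativity of resultants turns these into Res(f, p₂)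
Res(f, g) ~ Res(f, c) Res(f, P), where each factor other than Res(f, g) is computable, and a nonzero
Res(P, p₂) cancels. This needs gcd(a, c) = 1, achieved by replacing a with a + βb for suitable β,
which changes neither resultant. The cases c = 0 and μ = 0 are separate: both sides vanish. -/

theorem eval₂_smul_of_isHomogeneous {σ : Type*} {f : MvPolynomial σ R} {n : ℕ}
    (hf : f.IsHomogeneous n) (g : R →+* S) (z : S) (x : σ → S) :
    eval₂ g (fun i ↦ z * x i) f = z ^ n * eval₂ g x f := by
  classical
  rw [eval₂_eq, eval₂_eq, Finset.mul_sum]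
  refine Finset.sum_congr rfl fun d hd ↦ ?_
  have hn : ∑ i ∈ d.support, d i = n := by
    exact (hf.degree_eq_sum_deg_support hd).symm
  simp_rw [mul_pow]
  rw [Finset.prod_mul_distrib, Finset.prod_pow_eq_pow_sum, hn]
  ring

theorem dvd_eval₂_sub_eval₂ {σ : Type*} (f : MvPolynomial σ R) (g : R →+* S) (e : S)
    (x y : σ → S) (h : ∀ i, e ∣ x i - y i) : e ∣ eval₂ g x f - eval₂ g y f := by
  induction f using MvPolynomial.induction_on with
  | C r => simp
  | add p q hp hq =>
    rw [eval₂_add, eval₂_add, add_sub_add_comm]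
    exact dvd_add hp hq
  | mul_X p i hp =>
    rw [eval₂_mul, eval₂_mul, eval₂_X, eval₂_X]
    have : eval₂ g x p * x i - eval₂ g y p * y i =
      (eval₂ g x p - eval₂ g y p) * x i + eval₂ g y p * (x i - y i) := by ring
    rw [this]
    exact dvd_add (hp.mul_right _) ((h i).mul_left _)

/-- Two evaluations of a binary form are proportional modulo the determinant of the two points. -/
theorem det_dvd_eval₂_sub_eval₂ {f : MvPolynomial (Fin 2) R} {n : ℕ} (hf : f.IsHomogeneous n)
    (g : R →+* S) (x y : Fin 2 → S) (i : Fin 2) :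
    x 0 * y 1 - y 0 * x 1 ∣ y i ^ n * eval₂ g x f - x i ^ n * eval₂ g y f := by
  -- Both terms are values of `f`, at the rescaled points `y i • x` and `x i • y`, whose coordinates
  -- differ by 0 or ± the determinant.
  rw [← eval₂_smul_of_isHomogeneous hf, ← eval₂_smul_of_isHomogeneous hf]
  refine dvd_eval₂_sub_eval₂ f g _ _ _ fun j ↦ ?_
  fin_cases i <;> fin_cases j
  · simp [mul_comm]
  · exact ⟨-1, by simp⟩
  · exact ⟨1, by simp; ring⟩
  · simp [mul_comm]

theorem dehomog_add (f g : MvPolynomial (Fin 2) R) : dehomog (f + g) = dehomog f + dehomog g :=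
  map_add _ _ _

theorem dehomog_sub (f g : MvPolynomial (Fin 2) R) : dehomog (f - g) = dehomog f - dehomog g :=
  map_sub _ _ _

theorem dehomog_mul (f g : MvPolynomial (Fin 2) R) : dehomog (f * g) = dehomog f * dehomog g :=
  map_mul _ _ _

theorem dehomog_pow (f : MvPolynomial (Fin 2) R) (n : ℕ) : dehomog (f ^ n) = dehomog f ^ n :=
  map_pow _ _ _

theorem dehomog_C (r : R) : dehomog (C r : MvPolynomial (Fin 2) R) = Polynomial.C r := by
  simp [dehomog]

theorem dehomog_eq_sum (f : MvPolynomial (Fin 2) R) :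
    dehomog f = ∑ d ∈ f.support, Polynomial.monomial (d 0) (f.coeff d) := by
  rw [dehomog, aeval_def, eval₂_eq']
  refine Finset.sum_congr rfl fun d _ ↦ ?_
  simp [Fin.prod_univ_two, ← Polynomial.C_mul_X_pow_eq_monomial]

theorem IsHomogeneous.add_eq {f : MvPolynomial (Fin 2) R} {n : ℕ} (hf : f.IsHomogeneous n)
    {d : Fin 2 →₀ ℕ} (hd : d ∈ f.support) : d 0 + d 1 = n := by
  have := hf.degree_eq_sum_deg_support hd
  rwa [Finset.sum_subset (Finset.subset_univ _) (by simp), Fin.sum_univ_two, eq_comm] at this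

theorem natDegree_dehomog_le {f : MvPolynomial (Fin 2) R} {n : ℕ} (hf : f.IsHomogeneous n) :
    (dehomog f).natDegree ≤ n := by
  rw [dehomog_eq_sum]
  refine Polynomial.natDegree_sum_le_of_forall_le _ _ fun d hd ↦ ?_
  have := IsHomogeneous.add_eq hf hd
  exact (Polynomial.natDegree_monomial_le _).trans (by omega)

/-- A drop in degree is thus a zero at infinity, the point (1 : 0). -/
theorem coeff_dehomog {f : MvPolynomial (Fin 2) R} {n : ℕ} (hf : f.IsHomogeneous n) :
    (dehomog f).coeff n = eval ![1, 0] f := by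
  rw [dehomog_eq_sum, Polynomial.finsetSum_coeff, eval_eq']
  refine Finset.sum_congr rfl fun d hd ↦ ?_
  have := IsHomogeneous.add_eq hf hd
  rw [Polynomial.coeff_monomial]
  by_cases h : d 0 = n
  · have h1 : d 1 = 0 := by omega
    simp [Fin.prod_univ_two, h, h1]
  · have h1 : d 1 ≠ 0 := by omega
    simp [Fin.prod_univ_two, h, h1]

theorem eval_dehomog (f : MvPolynomial (Fin 2) R) (x : R) :
    (dehomog f).eval x = eval ![x, 1] f := by
  rw [dehomog_eq_sum, Polynomial.eval_finsetSum, eval_eq']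
  exact Finset.sum_congr rfl fun d _ ↦ by simp [Fin.prod_univ_two]

end General

variable {K : Type*} [Field K]

/-! ### Divisibility by su - tv, and zeros of forms. -/

theorem dehomog_inSV (f : Forms K) : dehomog (inSV f) = (dehomog f).map (C : K →+* Forms K) := by
  induction f using MvPolynomial.induction_on with
  | C r => simp [inSV, dehomog_C]
  | add p q hp hq =>
    rw [dehomog_add, Polynomial.map_add, ← hp, ← hq, ← dehomog_add, inSV, map_add]
    rfl
  | mul_X p i hp =>
    rw [dehomog_mul, Polynomial.map_mul, ← hp, inSV, map_mul, dehomog_mul]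
    congr 1
    fin_cases i <;> simp [dehomog]

theorem dehomog_inTU (f : Forms K) : dehomog (inTU f) = Polynomial.C f := dehomog_C f

theorem dehomog_diagForm :
    dehomog (diagForm K) = Polynomial.C (X 1) * Polynomial.X - Polynomial.C (X 0) := by
  rw [diagForm, dehomog_sub, dehomog_mul, dehomog_mul, dehomog_inSV, dehomog_inSV, dehomog_inTU,
    dehomog_inTU]
  simp only [dehomog, aeval_X, Matrix.cons_val_zero, Matrix.cons_val_one, Polynomial.map_X,
    Polynomial.map_one, mul_one, Polynomial.X_mul_C]

theorem inSV_eq_eval₂ (f : Forms K) :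
    inSV f = eval₂ ((C : Forms K →+* BiForms K).comp C) (fun i ↦ inSV (X i)) f := by
  rw [← eval₂_map]
  simp only [inSV, map_X]
  exact (eval₂_eta _).symm

theorem inTU_eq_eval₂ (f : Forms K) :
    inTU f = eval₂ ((C : Forms K →+* BiForms K).comp C) (fun i ↦ inTU (X i)) f := by
  conv_lhs => rw [← eval₂_eta f]
  rw [inTU, ← coe_eval₂Hom, ← coe_eval₂Hom, ← RingHom.comp_apply]
  refine DFunLike.congr_fun (MvPolynomial.ringHom_ext (fun r ↦ ?_) fun i ↦ ?_) f <;> simp [inTU]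

theorem diagForm_dvd {f : Forms K} {n : ℕ} (hf : f.IsHomogeneous n) :
    diagForm K ∣ inTU (X 1) ^ n * inSV f - inSV (X 1) ^ n * inTU f := by
  rw [inSV_eq_eval₂ f, inTU_eq_eval₂ f]
  exact det_dvd_eval₂_sub_eval₂ hf _ (fun i ↦ inSV (X i)) (fun i ↦ inTU (X i)) 1

theorem prime_inTU_X : Prime (inTU (X 1 : Forms K)) :=
  (prime_C_iff _).mpr (X_prime)

theorem not_inTU_X_dvd_diagForm : ¬ inTU (X 1 : Forms K) ∣ diagForm K := by
  intro h
  have h1 : inTU (X 1 : Forms K) ∣ inTU (X 0) * X 1 := by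
    have := dvd_sub (dvd_mul_left (inTU (X 1 : Forms K)) (inSV (X 0))) h
    simpa [diagForm, inSV] using this
  rw [inTU, inTU, C_dvd_iff_dvd_coeff] at h1
  have h2 := h1 (Finsupp.single 1 1)
  simp only [coeff_C_mul, coeff_X] at h2
  simp [X_dvd_X] at h2

/-- The variable u is prime and does not divide su - tv, so powers of u cancel. -/
theorem diagForm_dvd_of_dvd_mul {f : BiForms K} (k : ℕ)
    (h : diagForm K ∣ inTU (X 1) ^ k * f) : diagForm K ∣ f := by
  obtain ⟨g, hg⟩ := h
  induction k generalizing g with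
  | zero => exact ⟨g, by simpa using hg⟩
  | succ k ih =>
    have hdvd : inTU (X 1 : Forms K) ∣ diagForm K * g :=
      ⟨inTU (X 1) ^ k * f, by rw [← hg]; ring⟩
    obtain ⟨g', rfl⟩ := (prime_inTU_X.dvd_or_dvd hdvd).resolve_left not_inTU_X_dvd_diagForm
    refine ih g' (mul_left_cancel₀ (prime_inTU_X (K := K)).ne_zero ?_)
    linear_combination hg

/-- Modulo su - tv, u^n f(s,v) ≡ v^n f(t,u) for a form f of degree n, so u^n times the cross form is
≡ 0. -/
theorem diagForm_dvd_crossForm {a c : Forms K} {n : ℕ} (ha : a.IsHomogeneous n)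
    (hc : c.IsHomogeneous n) : diagForm K ∣ crossForm a c := by
  refine diagForm_dvd_of_dvd_mul n ?_
  have := dvd_sub ((diagForm_dvd ha).mul_right (inTU c)) ((diagForm_dvd hc).mul_right (inTU a))
  convert this using 1
  rw [crossForm]
  ring

theorem diagForm_dvd_substForm {a b c : Forms K} {p : Fin 3 → Forms K} {m : ℕ}
    (hp : ∀ i, (p i).IsHomogeneous m) (h : p 0 * a + p 1 * b + p 2 * c = 0) :
    diagForm K ∣ substForm a b c p := by
  refine diagForm_dvd_of_dvd_mul m ?_
  have := dvd_add (dvd_add ((diagForm_dvd (hp 0)).mul_right (inTU a))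
    ((diagForm_dvd (hp 1)).mul_right (inTU b))) ((diagForm_dvd (hp 2)).mul_right (inTU c))
  convert this using 1
  have h' : inTU (p 0) * inTU a + inTU (p 1) * inTU b + inTU (p 2) * inTU c = 0 := by
    simp only [inTU, ← C_mul, ← C_add, h, C_0]
  rw [substForm]
  linear_combination inSV (X 1) ^ m * h'

/-- A form vanishing at a point is divisible by the linear form of that point. -/
theorem linearForm_dvd {f : Forms K} {n : ℕ} (hf : f.IsHomogeneous n) {z : Fin 2 → K} (hz : z ≠ 0)
    (h : eval z f = 0) : X 0 * C (z 1) - C (z 0) * X 1 ∣ f := by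
  have key (i : Fin 2) : X 0 * C (z 1) - C (z 0) * X 1 ∣ C (z i) ^ n * f := by
    have := det_dvd_eval₂_sub_eval₂ hf (C : K →+* Forms K) X (fun i ↦ C (z i)) i
    have e : eval₂ (C : K →+* Forms K) (fun i ↦ C (z i)) f = C (eval z f) :=
      (MvPolynomial.eval₂_comp C z f).symm
    rwa [e, h, C_0, mul_zero, sub_zero, eval₂_eta] at this
  obtain ⟨i, hi⟩ := Function.ne_iff.mp hz
  have hu : IsUnit (C (z i) ^ n : Forms K) := ((isUnit_iff_ne_zero.mpr hi).map C).pow n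
  exact hu.dvd_mul_left.mp (key i)

theorem not_isUnit_linearForm (z : Fin 2 → K) :
    ¬ IsUnit (X 0 * C (z 1) - C (z 0) * X 1 : Forms K) := by
  intro h
  have := h.map (eval z)
  simp [mul_comm] at this

theorem eval_ne_zero_of_isRelPrime {a c : Forms K} {n : ℕ} (ha : a.IsHomogeneous n)
    (hc : c.IsHomogeneous n) (h : IsRelPrime a c) {z : Fin 2 → K} (hz : z ≠ 0)
    (h1 : eval z a = 0) (h2 : eval z c = 0) : False :=
  not_isUnit_linearForm z (h (linearForm_dvd ha hz h1) (linearForm_dvd hc hz h2))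

/-! ### Resultants with prescribed formal degrees, up to units. -/

section Resultant

open Polynomial (resultant)

variable {R : Type*} [CommRing R]

/-- Raising the formal degree on the right by e multiplies the resultant by `f.coeff m ^ e`, so the
excesses of the two factors add up. -/
theorem resultant_mul_right_of_le (f g₁ g₂ : Polynomial R) {m k₁ k₂ : ℕ} (hf : f.natDegree ≤ m)
    (h₁ : g₁.natDegree ≤ k₁) (h₂ : g₂.natDegree ≤ k₂) :
    resultant f (g₁ * g₂) m (k₁ + k₂) = resultant f g₁ m k₁ * resultant f g₂ m k₂ := by
  obtain ⟨e₁, rfl⟩ := Nat.exists_eq_add_of_le h₁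
  obtain ⟨e₂, rfl⟩ := Nat.exists_eq_add_of_le h₂
  rw [add_add_add_comm, Polynomial.resultant_add_right_deg _ _ _ _ _ Polynomial.natDegree_mul_le,
    Polynomial.resultant_add_right_deg _ _ _ _ _ le_rfl,
    Polynomial.resultant_add_right_deg _ _ _ _ _ le_rfl, Polynomial.resultant_mul_right _ _ _ _ hf]
  ring

theorem associated_resultant_comm (f g : Polynomial R) (m n : ℕ) :
    Associated (resultant f g m n) (resultant g f n m) := by
  rw [Polynomial.resultant_comm]
  exact associated_unit_mul_left _ _ (isUnit_one.neg.pow _)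

theorem associated_resultant_mul_left (f₁ f₂ g : Polynomial R) {m₁ m₂ n : ℕ}
    (h₁ : f₁.natDegree ≤ m₁) (h₂ : f₂.natDegree ≤ m₂) (hg : g.natDegree ≤ n) :
    Associated (resultant (f₁ * f₂) g (m₁ + m₂) n)
      (resultant f₁ g m₁ n * resultant f₂ g m₂ n) := by
  refine (associated_resultant_comm _ _ _ _).trans ?_
  rw [resultant_mul_right_of_le _ _ _ hg h₁ h₂]
  exact (associated_resultant_comm _ _ _ _).mul_mul (associated_resultant_comm _ _ _ _)

theorem associated_resultant_neg_left (f g : Polynomial R) (m n : ℕ) :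
    Associated (resultant (-f) g m n) (resultant f g m n) := by
  have := Polynomial.resultant_C_mul_left f g m n (-1)
  rw [map_neg, map_one, neg_one_mul] at this
  rw [this]
  exact associated_unit_mul_left _ _ (isUnit_one.neg.pow _)

/-- The resultant is a product of values of `g` at the roots of `f`; `htop` excludes a common root
at infinity. -/
theorem resultant_ne_zero_of_splits [IsDomain R] {f g : Polynomial R} {m n : ℕ}
    (hf : f.natDegree ≤ m) (hg : g.natDegree ≤ n) (hs : f.Splits) (h0 : f ≠ 0)
    (htop : f.coeff m = 0 → g.coeff n ≠ 0) (hroot : ∀ x ∈ f.roots, g.eval x ≠ 0) :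
    resultant f g m n ≠ 0 := by
  obtain ⟨e, rfl⟩ := Nat.exists_eq_add_of_le hf
  rw [Polynomial.resultant_add_left_deg _ _ _ _ _ le_rfl,
    Polynomial.resultant_eq_prod_eval _ _ _ hg hs]
  refine mul_ne_zero (mul_ne_zero (pow_ne_zero _ (neg_ne_zero.mpr one_ne_zero)) ?_)
    (mul_ne_zero (pow_ne_zero _ (Polynomial.leadingCoeff_ne_zero.mpr h0)) ?_)
  · rcases Nat.eq_zero_or_pos e with rfl | he
    · simp
    · exact pow_ne_zero _ (htop (Polynomial.coeff_eq_zero_of_natDegree_lt (by omega)))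
  · refine Multiset.prod_ne_zero fun h ↦ ?_
    obtain ⟨x, hx, hx'⟩ := Multiset.mem_map.mp h
    exact hroot x hx hx'

/-- Modulo uX - t, u^n g is the constant g'. The resultant with it is both u^n Res(uX - t, g) and g'
u^n, and u^n cancels. -/
theorem resultant_linear_left [IsDomain R] {t u g' : R} {g h : Polynomial R} {n : ℕ} (hn : 1 ≤ n)
    (hu : u ≠ 0) (hg : g.natDegree ≤ n)
    (hh : (Polynomial.C u * Polynomial.X - Polynomial.C t) * h =
      Polynomial.C (u ^ n) * g - Polynomial.C g') :
    resultant (Polynomial.C u * Polynomial.X - Polynomial.C t) g 1 n = g' := by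
  have hl : (Polynomial.C u * Polynomial.X - Polynomial.C t).natDegree = 1 := by
    rw [sub_eq_add_neg, ← Polynomial.C_neg, Polynomial.natDegree_linear hu]
  have hdeg : h.natDegree + 1 ≤ n := by
    rcases eq_or_ne h 0 with rfl | h0
    · simpa using hn
    · rw [← hl, add_comm, ← Polynomial.natDegree_mul (by rintro h; simp [h] at hl) h0, hh]
      refine (Polynomial.natDegree_sub_le _ _).trans (max_le ?_ (by simp))
      exact (Polynomial.natDegree_C_mul_le _ _).trans hg
  have h1 := Polynomial.resultant_C_mul_right (Polynomial.C u * Polynomial.X - Polynomial.C t) g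
    1 n (u ^ n)
  have h2 : Polynomial.C (u ^ n) * g =
      Polynomial.C g' + (Polynomial.C u * Polynomial.X - Polynomial.C t) * h := by
    rw [hh]; ring
  rw [h2, Polynomial.resultant_add_mul_right _ _ _ _ _ hdeg hl.le, Polynomial.resultant_C_right]
    at h1
  refine (mul_left_cancel₀ (pow_ne_zero n hu) ?_).symm
  simpa using h1

/-- The change of the resultant under the passage from a basis of syzygies to the cross forms. -/
theorem associated_resultant_of_relations [IsDomain R] {m k : ℕ} {t u a' c' γ : R}
    {p₁ p₂ q₂ a c P Q f g : Polynomial R}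
    (hp₁ : p₁.natDegree ≤ m + 1) (hp₂ : p₂.natDegree ≤ m + 1) (hq₂ : q₂.natDegree ≤ k + 1)
    (hc : c.natDegree ≤ m + k + 2)
    (hP : P.natDegree ≤ m) (hQ : Q.natDegree ≤ k)
    (hf : f.natDegree ≤ m + k + 1) (hg : g.natDegree ≤ m + k + 1)
    (hγ : IsUnit γ) (hc' : c' ≠ 0)
    (h₁ : c * P = -(p₁ * f + p₂ * g)) (h₂ : Polynomial.C γ * f = p₂ * Q - q₂ * P)
    (h₃ : (Polynomial.C u * Polynomial.X - Polynomial.C t) * f =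
      Polynomial.C c' * a - Polynomial.C a' * c)
    (h₄ : resultant (Polynomial.C u * Polynomial.X - Polynomial.C t) c 1 (m + k + 2) = c')
    (hac : IsUnit (resultant a c (m + k + 2) (m + k + 2)))
    (hqp : IsUnit (resultant q₂ p₂ (k + 1) (m + 1)))
    (hPp : resultant P p₂ m (m + 1) ≠ 0) :
    Associated (resultant f g (m + k + 1) (m + k + 1))
      (c' ^ (m + k + 1) * resultant P Q m k) := by
  have hγf (h : Polynomial R) (l : ℕ) : Associated (resultant f h (m + k + 1) l)
      (resultant (p₂ * Q - q₂ * P) h (m + k + 1) l) := by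
    rw [← h₂, Polynomial.resultant_C_mul_left]
    exact associated_unit_mul_right _ _ (hγ.pow _)
  have hl : (Polynomial.C u * Polynomial.X - Polynomial.C t).natDegree ≤ 1 := by
    rw [sub_eq_add_neg, ← Polynomial.C_neg]
    exact Polynomial.natDegree_linear_le
  -- `Res(f, p₂) Res(f, g) ∼ Res(f, c) Res(f, P)`
  have e₁ : Associated (resultant f p₂ (m + k + 1) (m + 1) *
        resultant f g (m + k + 1) (m + k + 1))
      (resultant f c (m + k + 1) (m + k + 2) * resultant f P (m + k + 1) m) := by
    rw [← resultant_mul_right_of_le _ _ _ hf hp₂ hg, ← resultant_mul_right_of_le _ _ _ hf hc hP,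
      show p₂ * g = Polynomial.C (-1) * (c * P) + f * -p₁ by
        rw [h₁, map_neg, map_one]; ring,
      Polynomial.resultant_add_mul_right _ _ _ _ _ (by rw [Polynomial.natDegree_neg]; omega) hf,
      Polynomial.resultant_C_mul_right, show m + 1 + (m + k + 1) = m + k + 2 + m by ring]
    exact associated_unit_mul_left _ _ (isUnit_one.neg.pow _)
  -- Modulo `P`, `γ f` is `p₂ Q`.
  have e₂ : Associated (resultant f P (m + k + 1) m)
      (resultant p₂ P (m + 1) m * resultant P Q m k) := by
    refine (hγf _ _).trans ?_
    rw [sub_eq_add_neg, mul_comm q₂, ← mul_neg, Polynomial.resultant_add_mul_left _ _ _ _ _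
      (by rw [Polynomial.natDegree_neg]; omega) hP, show m + k + 1 = m + 1 + k by ring]
    exact (associated_resultant_mul_left _ _ _ hp₂ hQ hP).trans
      ((Associated.refl _).mul_mul (associated_resultant_comm _ _ _ _))
  -- Modulo `p₂`, `γ f` is `-q₂ P`, and Res(q₂, p₂) is a unit.
  have e₃ : Associated (resultant f p₂ (m + k + 1) (m + 1)) (resultant P p₂ m (m + 1)) := by
    refine (hγf _ _).trans ?_
    rw [sub_eq_add_neg, add_comm, Polynomial.resultant_add_mul_left _ _ _ _ _ (by omega) hp₂,
      show m + k + 1 = k + 1 + m by ring]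
    refine (associated_resultant_neg_left _ _ _ _).trans
      ((associated_resultant_mul_left _ _ _ hq₂ hP hp₂).trans ?_)
    exact associated_unit_mul_left _ _ hqp
  -- Multiply `f` by uX - t: modulo `c` the product is `c' a`, whose resultant is `c' ^ (m + k + 2)`
  -- times a unit. The linear factor accounts for one `c'`.
  have e₄ : Associated (resultant f c (m + k + 1) (m + k + 2)) (c' ^ (m + k + 1)) := by
    have h5 := associated_resultant_mul_left _ _ _ hl hf hc
    rw [h₃, h₄, sub_eq_add_neg, ← mul_neg_one, mul_comm (Polynomial.C a'), mul_assoc,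
      Polynomial.resultant_add_mul_left, show 1 + (m + k + 1) = m + k + 2 by ring,
      Polynomial.resultant_C_mul_left, pow_succ' c' (m + k + 1), mul_assoc] at h5
    · refine ((Associated.of_mul_left h5 (Associated.refl _) hc').symm).trans ?_
      exact associated_mul_unit_left _ _ hac
    · rw [mul_neg_one, Polynomial.natDegree_neg, Polynomial.natDegree_C]
      omega
    · exact hc
  have e₅ : Associated (resultant P p₂ m (m + 1) * resultant f g (m + k + 1) (m + k + 1))
      (resultant P p₂ m (m + 1) * (c' ^ (m + k + 1) * resultant P Q m k)) := by
    refine ((e₃.symm.mul_mul (Associated.refl _)).trans e₁).trans ((e₄.mul_mul e₂).trans ?_)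
    rw [mul_left_comm]
    exact (associated_resultant_comm _ _ _ _).mul_mul (Associated.refl _)
  exact Associated.of_mul_left e₅ (Associated.refl _) hPp

end Resultant

/-! ### Minors of a Sylvester matrix with a common linear factor. -/

section Minors

open Polynomial (resultant sylvester)

variable {R : Type*} [CommRing R]

/-- The maximal minors of an `N × (N + 1)` matrix are proportional to a vector in its kernel. -/
theorem minor_mul_comm_of_mulVec_eq_zero {N : ℕ} (T : Matrix (Fin N) (Fin (N + 1)) R)
    (w : Fin (N + 1) → R) (hw : T.mulVec w = 0) (i j : Fin (N + 1)) :
    (-1) ^ (i : ℕ) * (T.submatrix id i.succAbove).det * w j =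
      (-1) ^ (j : ℕ) * (T.submatrix id j.succAbove).det * w i := by
  -- With the unit row e_i on top, `A w = w i • e_0`. Applying the adjugate, whose first column
  -- consists of the signed maximal minors of `T`, gives the claim, as det A is the signed i-th
  -- minor.
  let A : Matrix (Fin (N + 1)) (Fin (N + 1)) R := Matrix.of (Fin.cons (Pi.single i 1) T)
  have hA0 : A 0 = Pi.single i 1 := rfl
  have hAs (l : Fin N) : A l.succ = T l := rfl
  have hAw : A.mulVec w = Pi.single 0 (w i) := by
    ext l
    refine Fin.cases ?_ (fun l ↦ ?_) l
    · simp [hA0, Matrix.mulVec, dotProduct, Pi.single_apply]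
    · have := congrFun hw l
      simpa [hAs, Matrix.mulVec, dotProduct] using this
  have hsub (l : Fin (N + 1)) : A.submatrix Fin.succ l.succAbove = T.submatrix id l.succAbove := by
    ext x y
    simp [hAs]
  have hdet : A.det = (-1) ^ (i : ℕ) * (T.submatrix id i.succAbove).det := by
    rw [Matrix.det_succ_row_zero, Finset.sum_eq_single i, hsub]
    · simp [hA0]
    · intro b _ hb
      simp [hA0, hb]
    · simp
  have hadj := congrArg (A.adjugate.mulVec) hAw
  rw [Matrix.mulVec_mulVec, Matrix.adjugate_mul, Matrix.smul_mulVec, Matrix.one_mulVec] at hadj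
  have := congrFun hadj j
  rw [Pi.smul_apply, smul_eq_mul, hdet, Matrix.mulVec_single, Pi.smul_apply, Matrix.col_apply,
    Matrix.adjugate_fin_succ_eq_det_submatrix, Fin.succAbove_zero, hsub] at this
  simpa using this

theorem exists_eq_succAbove_comp {N : ℕ} (c : Fin N ↪ Fin (N + 1)) :
    ∃ (j : Fin (N + 1)) (σ : Equiv.Perm (Fin N)), ∀ x, c x = j.succAbove (σ x) := by
  have hns : ¬ Function.Surjective c := fun h ↦ by
    simpa using Fintype.card_le_of_surjective c h
  obtain ⟨j, hj⟩ := not_forall.mp hns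
  choose σ hσ using fun x ↦ Fin.exists_succAbove_eq (x := c x) (y := j) fun h ↦ hj ⟨x, h⟩
  have hinj : Function.Injective σ := fun x y h ↦ c.injective (by rw [← hσ, ← hσ, h])
  exact ⟨j, Equiv.ofBijective σ (Finite.injective_iff_bijective.mp hinj), fun x ↦ (hσ x).symm⟩

/-- The gcd of the r w_j is r times the gcd of the w_j, a unit. -/
theorem dvd_of_forall_dvd_mul [IsDomain R] [UniqueFactorizationMonoid R] {ι : Type*} [Fintype ι]
    {w : ι → R} (hw : ∀ h, (∀ j, h ∣ w j) → IsUnit h) {h r : R} (hr : ∀ j, h ∣ r * w j) :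
    h ∣ r := by
  let _ : StrongNormalizationMonoid R := UniqueFactorizationMonoid.strongNormalizationMonoid
  let _ : NormalizedGCDMonoid R := UniqueFactorizationMonoid.toNormalizedGCDMonoid R
  have h1 : h ∣ Finset.univ.gcd fun j ↦ r * w j := Finset.dvd_gcd fun j _ ↦ hr j
  have hu : IsUnit (Finset.univ.gcd w) := hw _ fun j ↦ Finset.gcd_dvd (Finset.mem_univ j)
  exact hu.dvd_mul_right.mp (h1.trans (Finset.gcd_mul_left' _ _ r).dvd)

/-- The index ranges in the definition of `sylvester` only cut off coefficients that already vanish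
by the degree bounds. -/
theorem sylvester_apply {f g : Polynomial R} {m n : ℕ} (hf : f.natDegree ≤ m)
    (hg : g.natDegree ≤ n) (i j : Fin (m + n)) :
    sylvester f g m n i j = (j.addCases (motive := fun _ ↦ Polynomial R)
      (fun j₁ ↦ g * Polynomial.X ^ (j₁ : ℕ)) (fun j₂ ↦ f * Polynomial.X ^ (j₂ : ℕ))).coeff i := by
  refine j.addCases (fun j ↦ ?_) fun j ↦ ?_
  all_goals
    simp only [sylvester, Matrix.of_apply, Fin.addCases_left, Fin.addCases_right, Set.mem_Icc,
      Polynomial.coeff_mul_X_pow']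
    split_ifs with h1 h2 h2
    · rfl
    · omega
    · rw [Polynomial.coeff_eq_zero_of_natDegree_lt]
      omega
    · rfl

/-- The matrix of `(A, B) ↦ A Q + B P` on polynomials of degrees at most `m` and `k`. -/
def combMatrix (P Q : Polynomial R) (m k : ℕ) : Matrix (Fin (m + 1 + k)) (Fin (m + 1 + k + 1)) R :=
  .of fun i j ↦ ((Fin.addCases (m := m + 1) (n := k + 1) (motive := fun _ ↦ Polynomial R)
      (fun j₁ ↦ Q * Polynomial.X ^ (j₁ : ℕ)) (fun j₂ ↦ P * Polynomial.X ^ (j₂ : ℕ)) j).coeff i)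

/-- The matrix of multiplication by `u X - t` on polynomials of degree less than `N`. -/
def linMatrix (t u : R) (N : ℕ) : Matrix (Fin (N + 1)) (Fin N) R :=
  .of fun i j ↦ ((Polynomial.C u * Polynomial.X - Polynomial.C t) *
    Polynomial.X ^ (j : ℕ)).coeff i

/-- The syzygy `(-P, Q)` of `(Q, P)`. -/
def combKernel (P Q : Polynomial R) (m k : ℕ) : Fin (m + 1 + k + 1) → R :=
  Fin.addCases (m := m + 1) (n := k + 1) (motive := fun _ ↦ R)
    (fun j₁ ↦ -P.coeff j₁) (fun j₂ ↦ Q.coeff j₂)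

theorem sum_coeff_mul_mul_X_pow (h f : Polynomial R) {N : ℕ} (hf : f.natDegree < N) :
    ∑ j : Fin N, Polynomial.C (f.coeff j) * (h * Polynomial.X ^ (j : ℕ)) = h * f := by
  conv_rhs => rw [f.as_sum_range' N hf, Finset.mul_sum, ← Fin.sum_univ_eq_sum_range
    (fun i ↦ h * Polynomial.monomial i (f.coeff i))]
  refine Finset.sum_congr rfl fun j _ ↦ ?_
  rw [← Polynomial.C_mul_X_pow_eq_monomial]
  ring

theorem natDegree_combMatrix_col {P Q : Polynomial R} {m k : ℕ} (hP : P.natDegree ≤ m)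
    (hQ : Q.natDegree ≤ k) (j : Fin (m + 1 + k + 1)) :
    (Fin.addCases (m := m + 1) (n := k + 1) (motive := fun _ ↦ Polynomial R)
      (fun j₁ ↦ Q * Polynomial.X ^ (j₁ : ℕ)) (fun j₂ ↦ P * Polynomial.X ^ (j₂ : ℕ)) j).natDegree <
      m + 1 + k := by
  refine Fin.addCases (m := m + 1) (n := k + 1) (fun j ↦ ?_) (fun j ↦ ?_) j
  · rw [Fin.addCases_left]
    refine (Polynomial.natDegree_mul_le.trans
      (add_le_add hQ (Polynomial.natDegree_X_pow_le _))).trans_lt ?_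
    omega
  · rw [Fin.addCases_right]
    refine (Polynomial.natDegree_mul_le.trans
      (add_le_add hP (Polynomial.natDegree_X_pow_le _))).trans_lt ?_
    omega

/-- Every column is the coefficient vector of uX - t times a polynomial of degree less than m + 1 +
k. -/
theorem sylvester_eq_mul {P Q : Polynomial R} {m k : ℕ} (t u : R) (hP : P.natDegree ≤ m)
    (hQ : Q.natDegree ≤ k) :
    sylvester ((Polynomial.C u * Polynomial.X - Polynomial.C t) * P)
      ((Polynomial.C u * Polynomial.X - Polynomial.C t) * Q) (m + 1) (k + 1) =
      linMatrix t u (m + 1 + k) * combMatrix P Q m k := by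
  have hl : (Polynomial.C u * Polynomial.X - Polynomial.C t).natDegree ≤ 1 := by
    rw [sub_eq_add_neg, ← Polynomial.C_neg]
    exact Polynomial.natDegree_linear_le
  have hlP : ((Polynomial.C u * Polynomial.X - Polynomial.C t) * P).natDegree ≤ m + 1 :=
    Polynomial.natDegree_mul_le.trans (by omega)
  have hlQ : ((Polynomial.C u * Polynomial.X - Polynomial.C t) * Q).natDegree ≤ k + 1 :=
    Polynomial.natDegree_mul_le.trans (by omega)
  ext i j
  rw [sylvester_apply hlP hlQ, Matrix.mul_apply]
  have h := congrArg (fun f ↦ Polynomial.coeff f (i : ℕ))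
    (sum_coeff_mul_mul_X_pow (Polynomial.C u * Polynomial.X - Polynomial.C t) _
      (natDegree_combMatrix_col hP hQ j))
  simp only [Polynomial.finsetSum_coeff, Polynomial.coeff_C_mul] at h
  have e : (∑ l, linMatrix t u (m + 1 + k) i l * combMatrix P Q m k l j) = _ :=
    (Finset.sum_congr rfl fun l _ ↦ mul_comm _ _).trans h
  rw [e]
  congr 1
  refine Fin.addCases (m := m + 1) (n := k + 1) (fun j ↦ ?_) (fun j ↦ ?_) j
  · rw [Fin.addCases_left, Fin.addCases_left, mul_assoc]
  · rw [Fin.addCases_right, Fin.addCases_right, mul_assoc]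

theorem combMatrix_mulVec_combKernel {P Q : Polynomial R} {m k : ℕ} (hP : P.natDegree ≤ m)
    (hQ : Q.natDegree ≤ k) : (combMatrix P Q m k).mulVec (combKernel P Q m k) = 0 := by
  ext i
  have h1 := sum_coeff_mul_mul_X_pow Q P (Nat.lt_succ_of_le hP)
  have h2 := sum_coeff_mul_mul_X_pow P Q (Nat.lt_succ_of_le hQ)
  have h3 : -(∑ j : Fin (m + 1), Polynomial.C (P.coeff j) * (Q * Polynomial.X ^ (j : ℕ))) +
      ∑ j : Fin (k + 1), Polynomial.C (Q.coeff j) * (P * Polynomial.X ^ (j : ℕ)) = 0 := by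
    rw [h1, h2]; ring
  have h4 := congrArg (fun f ↦ Polynomial.coeff f (i : ℕ)) h3
  simp only [Polynomial.coeff_add, Polynomial.coeff_neg, Polynomial.finsetSum_coeff,
    Polynomial.coeff_C_mul, Polynomial.coeff_zero, ← Finset.sum_neg_distrib] at h4
  rw [Matrix.mulVec, dotProduct, Pi.zero_apply, ← h4]
  refine (Fin.sum_univ_add (a := m + 1) (b := k + 1) _).trans ?_
  simp only [combMatrix, combKernel, Matrix.of_apply, Fin.addCases_left, Fin.addCases_right]
  simp only [mul_comm, neg_mul]

/-- Deleting the column of `P X^k` leaves the Sylvester matrix with formal degrees m + 1 and k. -/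
theorem det_combMatrix_last {P Q : Polynomial R} {m k : ℕ} (hP : P.natDegree ≤ m)
    (hQ : Q.natDegree ≤ k) :
    ((combMatrix P Q m k).submatrix id (Fin.last _).succAbove).det =
      (-1) ^ k * Q.coeff k * resultant P Q m k := by
  rw [← Polynomial.resultant_succ_left_deg _ _ _ _ hP, resultant]
  congr 1
  ext i j
  rw [sylvester_apply (hP.trans (Nat.le_succ _)) hQ]
  refine j.addCases (fun j ↦ ?_) fun j ↦ ?_
  · have : ((j.castAdd k).castSucc : Fin (m + 1 + k + 1)) = Fin.castAdd (k + 1) j := rfl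
    simp only [combMatrix, Matrix.submatrix_apply, Matrix.of_apply, Fin.succAbove_last, this, id,
      Fin.addCases_left]
  · have : ((j.natAdd (m + 1)).castSucc : Fin (m + 1 + k + 1)) = Fin.natAdd (m + 1) j.castSucc :=
      rfl
    simp only [combMatrix, Matrix.submatrix_apply, Matrix.of_apply, Fin.succAbove_last, this, id,
      Fin.addCases_right, Fin.val_castSucc]

/-- Deleting the column of `Q X^m` leaves the Sylvester matrix with formal degrees m and k + 1. -/
theorem det_combMatrix_castAdd_last {P Q : Polynomial R} {m k : ℕ} (hP : P.natDegree ≤ m)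
    (hQ : Q.natDegree ≤ k) :
    ((combMatrix P Q m k).submatrix id (Fin.castAdd (k + 1) (Fin.last m)).succAbove).det =
      P.coeff m * resultant P Q m k := by
  have := Polynomial.resultant_add_right_deg P Q m k 1 hQ
  rw [pow_one] at this
  rw [← this, resultant,
    ← Matrix.det_reindex_self (finCongr (show (m + 1).add k = m + (k + 1) by grind))]
  congr 1
  ext i j
  rw [sylvester_apply hP (hQ.trans (Nat.le_succ _))]
  refine j.addCases (fun j ↦ ?_) fun j ↦ ?_
  · have : ((Fin.last m).castAdd (k + 1)).succAbove ((j.castAdd (k + 1)).cast (by grind)) =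
        Fin.castAdd (k + 1) j.castSucc := by
      ext; simp [Fin.succAbove, Fin.lt_def]
    simp [combMatrix, this]
  · have : ((Fin.last m).castAdd (k + 1)).succAbove ((j.natAdd m).cast (by grind)) =
        Fin.natAdd (m + 1) j := by
      ext; simp [Fin.succAbove, Fin.lt_def, add_right_comm]
    simp [combMatrix, this]

theorem natDegree_le_of_coeff_eq_zero {f : Polynomial R} {m : ℕ} (hf : f.natDegree ≤ m + 1)
    (h : f.coeff (m + 1) = 0) : f.natDegree ≤ m := by
  refine Polynomial.natDegree_le_iff_coeff_eq_zero.mpr fun N hN ↦ ?_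
  rcases Nat.lt_or_ge (m + 1) N with h' | h'
  · exact Polynomial.coeff_eq_zero_of_natDegree_lt (hf.trans_lt h')
  · rwa [show N = m + 1 by omega]

theorem coeff_mul_X_pow_eq_zero {f : Polynomial R} {m i j : ℕ} (hf : f.natDegree ≤ m)
    (h : f.coeff m = 0) (hij : m + j ≤ i) : (f * Polynomial.X ^ j).coeff i = 0 := by
  rw [Polynomial.coeff_mul_X_pow', if_pos (by omega)]
  rcases Nat.lt_or_ge m (i - j) with h' | h'
  · exact Polynomial.coeff_eq_zero_of_natDegree_lt (hf.trans_lt h')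
  · rwa [show i - j = m by omega]

/-- The maximal minors of `combMatrix`. -/
theorem exists_det_combMatrix_eq [IsDomain R] {P Q : Polynomial R} {m k : ℕ}
    (hP : P.natDegree ≤ m) (hQ : Q.natDegree ≤ k) : ∃ ε : R, IsUnit ε ∧ ∀ j : Fin (m + 1 + k + 1),
      (-1) ^ (j : ℕ) * ((combMatrix P Q m k).submatrix id j.succAbove).det =
        ε * (resultant P Q m k * combKernel P Q m k j) := by
  have hcomm := minor_mul_comm_of_mulVec_eq_zero _ _ (combMatrix_mulVec_combKernel hP hQ)
  have key (i : Fin (m + 1 + k + 1)) (ε : R) (hε : IsUnit ε) (hi : combKernel P Q m k i ≠ 0)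
      (h : (-1) ^ (i : ℕ) * ((combMatrix P Q m k).submatrix id i.succAbove).det =
        ε * (resultant P Q m k * combKernel P Q m k i)) : ∃ ε : R, IsUnit ε ∧ ∀ j : Fin (m + 1 + k + 1),
      (-1) ^ (j : ℕ) * ((combMatrix P Q m k).submatrix id j.succAbove).det =
        ε * (resultant P Q m k * combKernel P Q m k j) := by
    refine ⟨ε, hε, fun j ↦ mul_right_cancel₀ hi ?_⟩
    rw [hcomm j i, h]
    ring
  have hlast : combKernel P Q m k (Fin.last _) = Q.coeff k := by
    change combKernel P Q m k (Fin.natAdd (m + 1) (Fin.last k)) = _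
    simp only [combKernel, Fin.addCases_right, Fin.val_last]
  have hmid : combKernel P Q m k (Fin.castAdd (k + 1) (Fin.last m)) = -P.coeff m := by
    simp only [combKernel, Fin.addCases_left, Fin.val_last]
  -- By proportionality, one minor with a nonzero kernel entry determines all; the two computed
  -- minors serve unless both top coefficients vanish.
  by_cases hQk : Q.coeff k = 0
  · by_cases hPm : P.coeff m = 0
    -- Here the row of X^(m+k) is zero, so all minors vanish. So does the resultant, except when m =
    -- k = 0: it is then 1, but the kernel vector is zero.
    · refine ⟨1, isUnit_one, fun j ↦ ?_⟩
      have hdet : ((combMatrix P Q m k).submatrix id j.succAbove).det = 0 := by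
        refine Matrix.det_eq_zero_of_row_eq_zero ⟨m + k, by omega⟩ fun l ↦ ?_
        rw [Matrix.submatrix_apply, combMatrix, Matrix.of_apply]
        generalize j.succAbove l = l
        refine Fin.addCases (m := m + 1) (n := k + 1) (fun j ↦ ?_) (fun j ↦ ?_) l
        · rw [Fin.addCases_left]
          exact coeff_mul_X_pow_eq_zero hQ hQk (by simp; omega)
        · rw [Fin.addCases_right]
          exact coeff_mul_X_pow_eq_zero hP hPm (by simp; omega)
      have hres : resultant P Q m k * combKernel P Q m k j = 0 := by
        rcases m with _ | m
        · rcases k with _ | k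
          · refine mul_eq_zero_of_right _ ?_
            have h0 : ∀ i : Fin 2, i = Fin.castAdd 1 (Fin.last 0) ∨ i = Fin.last 1 := by decide
            rcases h0 j with rfl | rfl
            · exact hmid.trans (by rw [hPm, neg_zero])
            · exact hlast.trans hQk
          · rw [Polynomial.resultant_add_right_deg _ _ _ _ _
              (natDegree_le_of_coeff_eq_zero hQ hQk), hPm]
            ring
        · rw [Polynomial.resultant_succ_left_deg _ _ _ _
            (natDegree_le_of_coeff_eq_zero hP hPm), hQk]
          ring
      rw [hdet, hres]
      ring
    · refine key (Fin.castAdd (k + 1) (Fin.last m)) ((-1) ^ (m + 1))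
        (isUnit_one.neg.pow _) (by rwa [hmid, neg_ne_zero]) ?_
      rw [det_combMatrix_castAdd_last hP hQ, hmid, Fin.val_castAdd, Fin.val_last]
      ring
  · refine key (Fin.last _) ((-1) ^ (m + 1 + k) * (-1) ^ k)
      ((isUnit_one.neg.pow _).mul (isUnit_one.neg.pow _)) (by rwa [hlast]) ?_
    rw [det_combMatrix_last hP hQ, hlast, Fin.val_last]
    ring

theorem det_linMatrix_castSucc (t u : R) (N : ℕ) :
    ((linMatrix t u N).submatrix Fin.castSucc id).det = (-t) ^ N := by
  rw [Matrix.det_of_isLowerTriangular]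
  · simp [linMatrix, Polynomial.coeff_mul_X_pow']
  · intro i j hij
    have hij' : (i : ℕ) < j := hij
    simp only [linMatrix, Matrix.submatrix_apply, Matrix.of_apply, Polynomial.coeff_mul_X_pow', id,
      Fin.val_castSucc]
    rw [if_neg (by omega)]

theorem det_linMatrix_succ (t u : R) (N : ℕ) :
    ((linMatrix t u N).submatrix Fin.succ id).det = u ^ N := by
  rw [Matrix.det_of_isUpperTriangular]
  · simp [linMatrix, Polynomial.coeff_mul_X_pow', Polynomial.coeff_C]
  · intro i j hij
    have hij' : (j : ℕ) < i := hij
    simp only [linMatrix, Matrix.submatrix_apply, Matrix.of_apply, Polynomial.coeff_mul_X_pow', id,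
      Fin.val_succ]
    rw [if_pos (by omega), Polynomial.coeff_sub, Polynomial.coeff_C_mul, Polynomial.coeff_X,
      Polynomial.coeff_C, if_neg (by omega), if_neg (by omega)]
    simp

/-- The submaximal minors of the Sylvester matrix of two polynomials with a common linear factor
have greatest common divisor the resultant of the cofactors. -/
theorem associated_resultant_of_isGCDOfMinors [IsDomain R] [UniqueFactorizationMonoid R]
    {P Q : Polynomial R} {m k : ℕ} {t u D : R} (hP : P.natDegree ≤ m) (hQ : Q.natDegree ≤ k)
    (htu : ∀ N, IsRelPrime ((-t) ^ N) (u ^ N))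
    (hPQ : ∀ h, (∀ i, h ∣ P.coeff i) → (∀ i, h ∣ Q.coeff i) → IsUnit h)
    (hD : IsGCDOfMinors (sylvester ((Polynomial.C u * Polynomial.X - Polynomial.C t) * P)
      ((Polynomial.C u * Polynomial.X - Polynomial.C t) * Q) (m + 1) (k + 1)) (m + 1 + k) D) :
    Associated (resultant P Q m k) D := by
  obtain ⟨ε, hε, hΔ⟩ := exists_det_combMatrix_eq hP hQ
  -- The inner dimension equals the size of the minors, so each minor is a single product of two
  -- determinants.
  have hsub (r c : Fin (m + 1 + k) ↪ Fin (m + 1 + k + 1)) :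
      ((sylvester ((Polynomial.C u * Polynomial.X - Polynomial.C t) * P)
        ((Polynomial.C u * Polynomial.X - Polynomial.C t) * Q) (m + 1) (k + 1)).submatrix r c).det =
      ((linMatrix t u (m + 1 + k)).submatrix r id).det *
        ((combMatrix P Q m k).submatrix id c).det := by
    rw [sylvester_eq_mul t u hP hQ, ← Matrix.det_mul]
    exact congrArg _ (Matrix.submatrix_mul _ _ r id c Function.bijective_id)
  have hneg (j : Fin (m + 1 + k + 1)) : IsUnit ((-1 : R) ^ (j : ℕ)) := isUnit_one.neg.pow _
  refine associated_of_dvd_dvd (hD.2 _ fun r c ↦ ?_) ?_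
  · obtain ⟨j, σ, hσ⟩ := exists_eq_succAbove_comp c
    rw [hsub r c]
    refine Dvd.dvd.mul_left ?_ _
    have e : (combMatrix P Q m k).submatrix id c =
        ((combMatrix P Q m k).submatrix id j.succAbove).submatrix id σ := by
      ext x y
      simp [hσ]
    rw [e, Matrix.det_permute']
    refine Dvd.dvd.mul_left ((hneg j).dvd_mul_left.mp ?_) _
    rw [hΔ j]
    exact (dvd_mul_right _ _).mul_left _
  -- Conversely, `D` divides each maximal minor of `combMatrix` times powers of t and of u (last or
  -- first row deleted), hence the minor itself, hence the resultant times every coefficient of `P`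
  -- and `Q`.
  · refine dvd_of_forall_dvd_mul (w := combKernel P Q m k) (fun h hh ↦ hPQ h ?_ ?_) fun j ↦ ?_
    · intro i
      rcases Nat.lt_or_ge i (m + 1) with hi | hi
      · have := hh (Fin.castAdd (k + 1) ⟨i, hi⟩)
        simpa only [combKernel, Fin.addCases_left, dvd_neg] using this
      · rw [Polynomial.coeff_eq_zero_of_natDegree_lt (by omega)]
        exact dvd_zero _
    · intro i
      rcases Nat.lt_or_ge i (k + 1) with hi | hi
      · have := hh (Fin.natAdd (m + 1) ⟨i, hi⟩)
        simpa only [combKernel, Fin.addCases_right] using this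
      · rw [Polynomial.coeff_eq_zero_of_natDegree_lt (by omega)]
        exact dvd_zero _
    · rw [← hε.dvd_mul_left, ← hΔ j, (hneg j).dvd_mul_left]
      refine dvd_of_forall_dvd_mul (w := ![(-t) ^ (m + 1 + k), u ^ (m + 1 + k)])
        (fun h hh ↦ htu _ (hh 0) (hh 1)) fun i ↦ ?_
      rw [mul_comm]
      fin_cases i
      · have := hD.1 Fin.castSuccEmb (Fin.succAboveEmb j)
        rw [hsub] at this
        exact det_linMatrix_castSucc t u (m + 1 + k) ▸ this
      · have := hD.1 (Fin.succEmb _) (Fin.succAboveEmb j)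
        rw [hsub] at this
        exact det_linMatrix_succ t u (m + 1 + k) ▸ this

end Minors

/-! ### Zeros, resultants and degrees of forms over an algebraically closed field. -/

section Forms

open Polynomial (resultant)

variable {K : Type*} [Field K]

theorem eq_zero_of_dehomog_eq_zero {f : Forms K} {n : ℕ} (hf : f.IsHomogeneous n)
    (h : dehomog f = 0) : f = 0 := by
  by_contra h0
  obtain ⟨d, hd⟩ := support_nonempty.mpr h0
  have h1 := congrArg (fun p ↦ Polynomial.coeff p (d 0)) h
  simp only [dehomog_eq_sum, Polynomial.finsetSum_coeff, Polynomial.coeff_monomial,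
    Polynomial.coeff_zero] at h1
  rw [Finset.sum_eq_single d] at h1
  · rw [if_pos rfl] at h1
    exact mem_support_iff.mp hd h1
  · intro e he hne
    refine if_neg fun h2 ↦ hne ?_
    have h3 := IsHomogeneous.add_eq hf he
    have h4 := IsHomogeneous.add_eq hf hd
    ext i
    fin_cases i
    · exact h2
    · change e 1 = d 1
      omega
  · intro h
    exact absurd hd h

theorem eval_eq_sum_coeff_dehomog {f : Forms K} {n : ℕ} (hf : f.IsHomogeneous n) (z : Fin 2 → K) :
    eval z f = ∑ i ∈ Finset.range (n + 1), (dehomog f).coeff i * (z 0 ^ i * z 1 ^ (n - i)) := by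
  simp only [dehomog_eq_sum, Polynomial.finsetSum_coeff, Polynomial.coeff_monomial, Finset.sum_mul]
  rw [Finset.sum_comm, eval_eq']
  refine Finset.sum_congr rfl fun d hd ↦ ?_
  have := IsHomogeneous.add_eq hf hd
  simp only [ite_mul, zero_mul, Finset.sum_ite_eq, Finset.mem_range, Fin.prod_univ_two]
  rw [if_pos (by omega), show n - d 0 = d 1 by omega]

theorem exists_eval_eq_zero [IsAlgClosed K] {f : Forms K} {n : ℕ} (hf : f.IsHomogeneous n)
    (hn : 1 ≤ n) : ∃ z : Fin 2 → K, z ≠ 0 ∧ eval z f = 0 := by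
  by_cases h : eval ![1, 0] f = 0
  · exact ⟨_, fun h ↦ one_ne_zero (congrFun h 0), h⟩
  · have hdeg : (dehomog f).natDegree ≠ 0 := by
      have := Polynomial.le_natDegree_of_ne_zero (by rwa [coeff_dehomog hf])
      omega
    obtain ⟨x, hx⟩ := IsAlgClosed.exists_root (dehomog f) fun h ↦
      hdeg (Polynomial.natDegree_eq_zero_iff_degree_le_zero.mpr h.le)
    exact ⟨![x, 1], fun h ↦ one_ne_zero (congrFun h 1), by rw [← eval_dehomog]; exact hx⟩

/-- Substitution of constants for the variables `s`, `v`. -/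
def evalSV (z : Fin 2 → K) : BiForms K →+* Forms K := eval fun i ↦ C (z i)

theorem evalSV_inSV (z : Fin 2 → K) (f : Forms K) : evalSV z (inSV f) = C (eval z f) := by
  rw [evalSV, inSV, eval_map]
  exact (MvPolynomial.eval₂_comp C z f).symm

theorem evalSV_inTU (z : Fin 2 → K) (f : Forms K) : evalSV z (inTU f) = f := eval_C _

theorem evalSV_diagForm_ne_zero {z : Fin 2 → K} (hz : z ≠ 0) : evalSV z (diagForm K) ≠ 0 := by
  intro h
  rw [diagForm, map_sub, map_mul, map_mul, evalSV_inSV, evalSV_inSV, evalSV_inTU, evalSV_inTU,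
    eval_X, eval_X] at h
  refine hz (funext fun i ↦ ?_)
  fin_cases i
  · simpa using congrArg (eval ![0, 1]) h
  · simpa using congrArg (eval ![1, 0]) h

theorem diagForm_ne_zero : diagForm K ≠ 0 := fun h ↦
  evalSV_diagForm_ne_zero (K := K) (z := ![1, 0]) (fun h ↦ one_ne_zero (congrFun h 0))
    (by rw [h, map_zero])

theorem eval_dehomog_eq_evalSV (G : BiForms K) (x : K) :
    (dehomog G).eval (C x) = evalSV ![x, 1] G := by
  rw [eval_dehomog, evalSV]
  congr 2
  ext i : 1
  fin_cases i <;> simp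

theorem natDegree_map_dehomog_le {f : Forms K} {n : ℕ} (hf : f.IsHomogeneous n) :
    ((dehomog f).map (C : K →+* Forms K)).natDegree ≤ n :=
  Polynomial.natDegree_map_le.trans (natDegree_dehomog_le hf)

/-- A form with coefficients in `K` splits already over `K`, so `G` need only be tested at constant
points. -/
theorem resultant_map_dehomog_ne_zero [IsAlgClosed K] {f : Forms K} {m n : ℕ}
    (hf : f.IsHomogeneous m) {G : BiForms K} (hG : (dehomog G).natDegree ≤ n) (h0 : f ≠ 0)
    (htop : eval ![1, 0] f = 0 → (dehomog G).coeff n ≠ 0)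
    (hroot : ∀ x, eval ![x, 1] f = 0 → evalSV ![x, 1] G ≠ 0) :
    resultant ((dehomog f).map (C : K →+* Forms K)) (dehomog G) m n ≠ 0 := by
  have hs := IsAlgClosed.splits (dehomog f)
  refine resultant_ne_zero_of_splits (natDegree_map_dehomog_le hf) hG (hs.map C) ?_ ?_ ?_
  · rw [Ne, Polynomial.map_eq_zero_iff (C_injective _ _)]
    exact fun h ↦ h0 (eq_zero_of_dehomog_eq_zero hf h)
  · rw [Polynomial.coeff_map, coeff_dehomog hf, map_eq_zero_iff _ (C_injective _ _)]
    exact htop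
  · intro x hx
    rw [hs.roots_map] at hx
    obtain ⟨y, hy, rfl⟩ := Multiset.mem_map.mp hx
    rw [eval_dehomog_eq_evalSV]
    exact hroot y (by rw [← eval_dehomog]; exact Polynomial.isRoot_of_mem_roots hy)

theorem isUnit_resultant_map_dehomog [IsAlgClosed K] {f g : Forms K} {m n : ℕ}
    (hf : f.IsHomogeneous m) (hg : g.IsHomogeneous n) (hn : 1 ≤ n)
    (h : ∀ z : Fin 2 → K, z ≠ 0 → eval z f = 0 → eval z g = 0 → False) :
    IsUnit (resultant ((dehomog f).map (C : K →+* Forms K))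
      ((dehomog g).map (C : K →+* Forms K)) m n) := by
  have hne : resultant (dehomog f) (dehomog g) m n ≠ 0 := by
    refine resultant_ne_zero_of_splits (natDegree_dehomog_le hf) (natDegree_dehomog_le hg)
      (IsAlgClosed.splits _) ?_ ?_ ?_
    · intro h0
      -- If `f = 0`, any zero of `g` is a common zero; this is where `1 ≤ n` enters.
      obtain ⟨z, hz, hz'⟩ := exists_eval_eq_zero hg hn
      exact h z hz (by rw [eq_zero_of_dehomog_eq_zero hf h0, map_zero]) hz'
    · rw [coeff_dehomog hf, coeff_dehomog hg]
      exact h _ fun h ↦ one_ne_zero (congrFun h 0)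
    · intro x hx
      have := Polynomial.isRoot_of_mem_roots hx
      rw [Polynomial.IsRoot, eval_dehomog] at this
      rw [eval_dehomog]
      exact h _ (fun h ↦ one_ne_zero (congrFun h 1)) this
  rw [Polynomial.resultant_map_map]
  exact (isUnit_iff_ne_zero.mpr hne).map C

theorem natDegree_dehomog_of_diagForm_mul {G H : BiForms K} {n : ℕ} (h : G = diagForm K * H)
    (hG : (dehomog G).natDegree ≤ n + 1) : (dehomog H).natDegree ≤ n := by
  rcases eq_or_ne (dehomog H) 0 with h0 | h0
  · simp [h0]
  have hl : (dehomog (diagForm K)).natDegree = 1 := by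
    rw [dehomog_diagForm, sub_eq_add_neg, ← Polynomial.C_neg,
      Polynomial.natDegree_linear (X_ne_zero _)]
  rw [h, dehomog_mul, Polynomial.natDegree_mul (by rintro h; simp [h] at hl) h0, hl] at hG
  omega

theorem natDegree_dehomog_mul_inTU_le {f : Forms K} {n : ℕ} (hf : f.IsHomogeneous n) (g : Forms K) :
    (dehomog (inSV f * inTU g)).natDegree ≤ n := by
  rw [dehomog_mul, dehomog_inSV, dehomog_inTU]
  exact (Polynomial.natDegree_mul_C_le _ _).trans (natDegree_map_dehomog_le hf)

theorem natDegree_dehomog_crossForm_le {a c : Forms K} {n : ℕ} (ha : a.IsHomogeneous n)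
    (hc : c.IsHomogeneous n) : (dehomog (crossForm a c)).natDegree ≤ n := by
  rw [crossForm, mul_comm (inTU a), dehomog_sub]
  exact (Polynomial.natDegree_sub_le _ _).trans
    (max_le (natDegree_dehomog_mul_inTU_le ha c) (natDegree_dehomog_mul_inTU_le hc a))

theorem natDegree_dehomog_substForm_le {p : Fin 3 → Forms K} {n : ℕ}
    (hp : ∀ i, (p i).IsHomogeneous n) (a b c : Forms K) :
    (dehomog (substForm a b c p)).natDegree ≤ n := by
  rw [substForm, dehomog_add, dehomog_add]
  exact Polynomial.natDegree_add_le_of_degree_le (Polynomial.natDegree_add_le_of_degree_le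
    (natDegree_dehomog_mul_inTU_le (hp 0) a) (natDegree_dehomog_mul_inTU_le (hp 1) b))
    (natDegree_dehomog_mul_inTU_le (hp 2) c)

theorem evalSV_substForm (z : Fin 2 → K) (a b c : Forms K) (p : Fin 3 → Forms K) :
    evalSV z (substForm a b c p) =
      C (eval z (p 0)) * a + C (eval z (p 1)) * b + C (eval z (p 2)) * c := by
  simp only [substForm, map_add, map_mul, evalSV_inSV, evalSV_inTU]

theorem coeff_dehomog_substForm {p : Fin 3 → Forms K} {n : ℕ}
    (hp : ∀ i, (p i).IsHomogeneous n) (a b c : Forms K) :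
    (dehomog (substForm a b c p)).coeff n = evalSV ![1, 0] (substForm a b c p) := by
  rw [evalSV_substForm, substForm]
  simp only [dehomog_add, dehomog_mul, dehomog_inSV, dehomog_inTU, Polynomial.coeff_add,
    Polynomial.coeff_mul_C, Polynomial.coeff_map, coeff_dehomog (hp _)]

theorem coeff_dehomog_diagForm_mul {H : BiForms K} {n : ℕ} (hH : (dehomog H).natDegree ≤ n) :
    (dehomog (diagForm K * H)).coeff (n + 1) = X 1 * (dehomog H).coeff n := by
  rw [dehomog_mul, dehomog_diagForm, sub_mul, mul_assoc, Polynomial.coeff_sub,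
    Polynomial.coeff_C_mul, Polynomial.coeff_C_mul, Polynomial.coeff_X_mul,
    Polynomial.coeff_eq_zero_of_natDegree_lt (Nat.lt_succ_of_le hH)]
  ring

theorem isRelPrime_pow_X (N : ℕ) :
    IsRelPrime ((-X 0 : Forms K) ^ N) ((X 1 : Forms K) ^ N) := by
  refine IsRelPrime.pow ?_
  rw [IsRelPrime.neg_left_iff, X_prime.irreducible.isRelPrime_iff_not_dvd, X_dvd_X]
  decide

/-- Forms of positive degree without common zeros are linearly independent. -/
theorem eq_zero_of_linear_relation [IsAlgClosed K] {a c : Forms K} {n : ℕ}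
    (ha : a.IsHomogeneous n) (hc : c.IsHomogeneous n) (hn : 1 ≤ n)
    (hz : ∀ z : Fin 2 → K, z ≠ 0 → eval z a = 0 → eval z c = 0 → False) {x y : K}
    (h : C x * a + C y * c = 0) : x = 0 ∧ y = 0 := by
  constructor
  · obtain ⟨z, hz0, hz1⟩ := exists_eval_eq_zero hc hn
    have := congrArg (eval z) h
    simp only [map_add, map_mul, eval_C, hz1, mul_zero, add_zero, map_zero, mul_eq_zero] at this
    exact this.resolve_right fun h ↦ hz z hz0 h hz1
  · obtain ⟨z, hz0, hz1⟩ := exists_eval_eq_zero ha hn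
    have := congrArg (eval z) h
    simp only [map_add, map_mul, eval_C, hz1, mul_zero, zero_add, map_zero, mul_eq_zero] at this
    exact this.resolve_right fun h ↦ hz z hz0 hz1 h

/-! ### Relations between the cofactors of su - tv. -/

variable {m k : ℕ} {a b c : Forms K} {p q : Fin 3 → Forms K} {γ : K}
  {F G P Q : BiForms K}

/-- Subtracting c(t,u) times the syzygy in (s,v) from c(s,v) p_φ cancels the `p 2` terms and leaves
cross forms. -/
theorem cofactor_relation_left (sp : p 0 * a + p 1 * b + p 2 * c = 0)
    (hF : crossForm a c = diagForm K * F) (hG : crossForm b c = diagForm K * G)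
    (hP : substForm a b c p = diagForm K * P) :
    inSV c * P = -(inSV (p 0) * F + inSV (p 1) * G) := by
  refine mul_left_cancel₀ (diagForm_ne_zero (K := K)) ?_
  have sp' : inSV (p 0) * inSV a + inSV (p 1) * inSV b + inSV (p 2) * inSV c = 0 := by
    simpa [inSV] using congrArg inSV sp
  simp only [crossForm, substForm] at hF hG hP
  linear_combination (-inSV c) * hP - inSV (p 0) * hF - inSV (p 1) * hG + inTU c * sp'

/-- In p₂ q_φ - q₂ p_φ the b(t,u) terms cancel, and the coefficients of a(t,u) and c(t,u) are the 2
× 2 minors -γ c(s,v) and γ a(s,v). -/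
theorem cofactor_relation_right (ea : C γ * a = p 1 * q 2 - p 2 * q 1)
    (ec : C γ * c = p 0 * q 1 - p 1 * q 0)
    (hF : crossForm a c = diagForm K * F) (hP : substForm a b c p = diagForm K * P)
    (hQ : substForm a b c q = diagForm K * Q) :
    inTU (C γ) * F = inSV (p 1) * Q - inSV (q 1) * P := by
  refine mul_left_cancel₀ (diagForm_ne_zero (K := K)) ?_
  have ea' : inTU (C γ) * inSV a = inSV (p 1) * inSV (q 2) - inSV (p 2) * inSV (q 1) := by
    simpa [inSV, inTU] using congrArg inSV ea
  have ec' : inTU (C γ) * inSV c = inSV (p 0) * inSV (q 1) - inSV (p 1) * inSV (q 0) := by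
    simpa [inSV, inTU] using congrArg inSV ec
  simp only [crossForm, substForm] at hF hP hQ
  linear_combination inSV (p 1) * hQ - inSV (q 1) * hP - inTU (C γ) * hF + inTU c * ea' -
    inTU a * ec'

/-- By `cofactor_relation_right`, `h` divides the cross form, hence a(z) c - c(z) a for all z.
Taking z a zero of `a`, then of `c`, shows that `h` divides both. -/
theorem isUnit_of_dvd_coeff_cofactors [IsAlgClosed K] {n : ℕ} (ha : a.IsHomogeneous n)
    (hc : c.IsHomogeneous n) (hn : 1 ≤ n) (hac : IsRelPrime a c) (hγ : γ ≠ 0)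
    (ea : C γ * a = p 1 * q 2 - p 2 * q 1) (ec : C γ * c = p 0 * q 1 - p 1 * q 0)
    (hF : crossForm a c = diagForm K * F) (hP : substForm a b c p = diagForm K * P)
    (hQ : substForm a b c q = diagForm K * Q) (h : Forms K)
    (h₁ : ∀ i, h ∣ (dehomog P).coeff i) (h₂ : ∀ i, h ∣ (dehomog Q).coeff i) : IsUnit h := by
  have hrel := congrArg dehomog (cofactor_relation_right ea ec hF hP hQ)
  rw [dehomog_mul, dehomog_sub, dehomog_mul, dehomog_mul, dehomog_inTU] at hrel
  rw [← Polynomial.C_dvd_iff_dvd_coeff] at h₁ h₂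
  have hu : IsUnit (Polynomial.C (C γ) : Polynomial (Forms K)) :=
    ((isUnit_iff_ne_zero.mpr hγ).map C).map Polynomial.C
  have hdF : Polynomial.C h ∣ dehomog (crossForm a c) := by
    rw [hF, dehomog_mul]
    refine Dvd.dvd.mul_left (hu.dvd_mul_left.mp ?_) _
    rw [hrel]
    exact dvd_sub (h₂.mul_left _) (h₁.mul_left _)
  have hcoeff (i : ℕ) : h ∣ C ((dehomog a).coeff i) * c - C ((dehomog c).coeff i) * a := by
    have := (Polynomial.C_dvd_iff_dvd_coeff _ _).mp hdF i
    rw [crossForm, mul_comm (inTU a)] at this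
    simpa only [dehomog_sub, dehomog_mul, dehomog_inSV, dehomog_inTU, Polynomial.coeff_sub,
      Polynomial.coeff_mul_C, Polynomial.coeff_map] using this
  have heval (z : Fin 2 → K) : h ∣ C (eval z a) * c - C (eval z c) * a := by
    rw [eval_eq_sum_coeff_dehomog ha, eval_eq_sum_coeff_dehomog hc, map_sum, map_sum,
      Finset.sum_mul, Finset.sum_mul, ← Finset.sum_sub_distrib]
    refine Finset.dvd_sum fun i _ ↦ ?_
    rw [C_mul, C_mul (a := (dehomog c).coeff i), mul_right_comm,
      mul_right_comm (C ((dehomog c).coeff i)), ← sub_mul]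
    exact (hcoeff i).mul_right _
  have hz (z : Fin 2 → K) (hz0 : z ≠ 0) (h1 : eval z a = 0) (h2 : eval z c = 0) : False :=
    eval_ne_zero_of_isRelPrime ha hc hac hz0 h1 h2
  refine hac ?_ ?_
  · obtain ⟨z, hz0, hz1⟩ := exists_eval_eq_zero ha hn
    have h1 := heval z
    rw [hz1, C_0, zero_mul, zero_sub, dvd_neg] at h1
    exact ((isUnit_iff_ne_zero.mpr (hz z hz0 hz1)).map C).dvd_mul_left.mp h1
  · obtain ⟨z, hz0, hz1⟩ := exists_eval_eq_zero hc hn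
    have h1 := heval z
    rw [hz1, C_0, zero_mul, sub_zero] at h1
    exact ((isUnit_iff_ne_zero.mpr fun h ↦ hz z hz0 h hz1).map C).dvd_mul_left.mp h1

/-- The resultant of the cross forms, when the first and last coordinates are coprime. -/
theorem associated_formResultant_of_isRelPrime [IsAlgClosed K]
    (ha : a.IsHomogeneous (m + k + 2)) (hb : b.IsHomogeneous (m + k + 2))
    (hc : c.IsHomogeneous (m + k + 2)) (hp : ∀ i, (p i).IsHomogeneous (m + 1))
    (hq : ∀ i, (q i).IsHomogeneous (k + 1)) (hγ : γ ≠ 0) (hc0 : c ≠ 0) (hac : IsRelPrime a c)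
    (sp : p 0 * a + p 1 * b + p 2 * c = 0)
    (ea : C γ * a = p 1 * q 2 - p 2 * q 1) (ec : C γ * c = p 0 * q 1 - p 1 * q 0)
    (hF : crossForm a c = diagForm K * F) (hG : crossForm b c = diagForm K * G)
    (hP : substForm a b c p = diagForm K * P) (hQ : substForm a b c q = diagForm K * Q) :
    Associated (formResultant F G (m + k + 1) (m + k + 1))
      (c ^ (m + k + 1) * resultant (dehomog P) (dehomog Q) m k) := by
  have hz (z : Fin 2 → K) (hz0 : z ≠ 0) (h1 : eval z a = 0) (h2 : eval z c = 0) : False :=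
    eval_ne_zero_of_isRelPrime ha hc hac hz0 h1 h2
  -- Under these vanishings the minors equal to `γ a` and `γ c` both vanish at `z`.
  have hz' (z : Fin 2 → K) (hz0 : z ≠ 0) (h1 : eval z (p 1) = 0)
      (h2 : eval z (p 2 * q 1) = 0) (h3 : eval z (p 0 * q 1) = 0) : False := by
    refine hz z hz0 ?_ ?_
    · have := congrArg (eval z) ea
      rw [map_sub, map_mul, map_mul, h1, h2, eval_C, zero_mul, sub_zero, mul_eq_zero] at this
      exact this.resolve_left hγ
    · have := congrArg (eval z) ec
      rw [map_sub, map_mul, map_mul (eval z) (p 1), h1, h3, eval_C, zero_mul, sub_zero,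
        mul_eq_zero] at this
      exact this.resolve_left hγ
  have hPdeg : (dehomog P).natDegree ≤ m :=
    natDegree_dehomog_of_diagForm_mul hP (natDegree_dehomog_substForm_le hp a b c)
  have hQdeg : (dehomog Q).natDegree ≤ k :=
    natDegree_dehomog_of_diagForm_mul hQ (natDegree_dehomog_substForm_le hq a b c)
  -- At a zero of `p 1`, p_φ becomes a combination of the independent forms `a` and `c`; its
  -- vanishing would force `p 0` and `p 2` to vanish there too.
  have hP0 (z : Fin 2 → K) (hz0 : z ≠ 0) (h1 : eval z (p 1) = 0) :
      evalSV z (substForm a b c p) ≠ 0 := by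
    intro h
    rw [evalSV_substForm, h1, C_0, zero_mul, add_zero] at h
    obtain ⟨h2, h3⟩ := eq_zero_of_linear_relation ha hc (by omega) hz h
    exact hz' z hz0 h1 (by rw [map_mul, h3, zero_mul]) (by rw [map_mul, h2, zero_mul])
  obtain ⟨h, hh⟩ := diagForm_dvd hc
  have hh' := congrArg dehomog hh
  have hX1 : dehomog (inSV (X 1 : Forms K)) = 1 := by
    rw [dehomog_inSV]; simp [dehomog]
  have hpow : dehomog (inTU (X 1 : Forms K) ^ (m + k + 2)) = Polynomial.C (X 1 ^ (m + k + 2)) := by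
    rw [inTU, ← C_pow, dehomog_C]
  have hpow' : dehomog (inSV (X 1 : Forms K) ^ (m + k + 2)) = 1 := by
    rw [dehomog_pow, hX1, one_pow]
  rw [dehomog_sub, dehomog_mul, dehomog_mul, dehomog_mul, hpow, hpow', dehomog_diagForm,
    dehomog_inSV, dehomog_inTU, one_mul] at hh'
  refine associated_resultant_of_relations (t := X 0) (u := X 1) (a' := a) (γ := C γ)
    (p₁ := (dehomog (p 0)).map C) (p₂ := (dehomog (p 1)).map C) (q₂ := (dehomog (q 1)).map C)
    (a := (dehomog a).map C) (c := (dehomog c).map C)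
    (natDegree_map_dehomog_le (hp 0)) (natDegree_map_dehomog_le (hp 1))
    (natDegree_map_dehomog_le (hq 1)) (natDegree_map_dehomog_le hc) hPdeg hQdeg
    (natDegree_dehomog_of_diagForm_mul hF (natDegree_dehomog_crossForm_le ha hc))
    (natDegree_dehomog_of_diagForm_mul hG (natDegree_dehomog_crossForm_le hb hc))
    ((isUnit_iff_ne_zero.mpr hγ).map C) hc0 ?_ ?_ ?_ ?_ ?_ ?_ ?_
  · have := congrArg dehomog (cofactor_relation_left sp hF hG hP)
    rw [dehomog_mul, dehomog_inSV] at this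
    rw [this, ← dehomog_inSV, ← dehomog_inSV, ← dehomog_mul, ← dehomog_mul, ← dehomog_add]
    exact map_neg _ _
  · have := congrArg dehomog (cofactor_relation_right ea ec hF hP hQ)
    rwa [dehomog_mul, dehomog_sub, dehomog_mul, dehomog_mul, dehomog_inTU, dehomog_inSV,
      dehomog_inSV] at this
  · rw [← dehomog_diagForm, ← dehomog_mul, ← hF, crossForm, dehomog_sub, dehomog_mul, dehomog_mul,
      dehomog_inSV, dehomog_inSV, dehomog_inTU, dehomog_inTU]
    ring
  · exact resultant_linear_left (by omega) (X_ne_zero _) (natDegree_map_dehomog_le hc) hh'.symm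
  · exact isUnit_resultant_map_dehomog ha hc (by omega) hz
  · exact isUnit_resultant_map_dehomog (hq 1) (hp 1) (by omega) fun z hz0 h1 h2 ↦
      hz' z hz0 h2 (by rw [map_mul, h1, mul_zero]) (by rw [map_mul, h1, mul_zero])
  · rw [Ne, (associated_resultant_comm _ _ _ _).eq_zero_iff]
    refine resultant_map_dehomog_ne_zero (hp 1) hPdeg ?_ ?_ ?_
    · intro h0
      obtain ⟨z, hz0, hz1⟩ := exists_eval_eq_zero (hq 1) (by omega)
      exact hz' z hz0 (by rw [h0, map_zero]) (by rw [map_mul, hz1, mul_zero])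
        (by rw [map_mul, hz1, mul_zero])
    · intro h1 h2
      refine hP0 ![1, 0] (fun h ↦ one_ne_zero (congrFun h 0)) h1 ?_
      rw [← coeff_dehomog_substForm hp, hP, coeff_dehomog_diagForm_mul hPdeg, h2, mul_zero]
    · intro x h1 h2
      refine hP0 ![x, 1] (fun h ↦ one_ne_zero (congrFun h 1)) h1 ?_
      rw [hP, map_mul, h2, mul_zero]

/-- An irreducible factor of `c` divides `a + βb` for at most one β: otherwise it would divide `b`
and `a`. Finitely many β are excluded. -/
theorem exists_isRelPrime_add_mul [Infinite K] (hc : c ≠ 0)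
    (h : ∀ h : Forms K, h ∣ a → h ∣ b → h ∣ c → IsUnit h) :
    ∃ β : K, IsRelPrime (a + C β * b) c := by
  classical
  let s := (UniqueFactorizationMonoid.factors c).toFinset
  have hfin : (⋃ π ∈ s, {β : K | π ∣ a + C β * b}).Finite := by
    refine s.finite_toSet.biUnion fun π hπ ↦ Set.Subsingleton.finite fun β hβ β' hβ' ↦ ?_
    have hπ' := Multiset.mem_toFinset.mp hπ
    by_contra hne
    have hu : IsUnit (C (β - β') : Forms K) :=
      (isUnit_iff_ne_zero.mpr (sub_ne_zero.mpr hne)).map C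
    have hb : π ∣ b := by
      refine hu.dvd_mul_left.mp ?_
      have := dvd_sub (show π ∣ _ from hβ) (show π ∣ _ from hβ')
      rw [C_sub]
      convert this using 1
      ring
    have ha : π ∣ a := (dvd_add_left (hb.mul_left (C β))).mp hβ
    exact (UniqueFactorizationMonoid.irreducible_of_factor π hπ').not_isUnit
      (h π ha hb (UniqueFactorizationMonoid.dvd_of_mem_factors hπ'))
  obtain ⟨β, hβ⟩ := hfin.exists_notMem
  refine ⟨β, fun e he hec ↦ by_contra fun hu ↦ ?_⟩
  obtain ⟨π, hπ, hπe⟩ := WfDvdMonoid.exists_irreducible_factor hu (ne_zero_of_dvd_ne_zero hc hec)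
  obtain ⟨π', hmem, hass⟩ :=
    UniqueFactorizationMonoid.exists_mem_factors_of_dvd hc hπ (hπe.trans hec)
  refine hβ (Set.mem_biUnion (x := π') (Multiset.mem_toFinset.mpr hmem) ?_)
  exact hass.symm.dvd.trans (hπe.trans he)

/-- Both syzygies are orthogonal to (a, b, c), so p × q is proportional to it. Coprimality makes the
factor a polynomial, independence makes it nonzero, and comparing degrees makes it constant. -/
theorem exists_cross_eq {n l : ℕ} (hc : c.IsHomogeneous (n + l))
    (hp : ∀ i, (p i).IsHomogeneous n) (hq : ∀ i, (q i).IsHomogeneous l) (hc0 : c ≠ 0)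
    (hco : ∀ h : Forms K, h ∣ a → h ∣ b → h ∣ c → IsUnit h)
    (hli : LinearIndependent (Forms K) ![p, q])
    (sp : p 0 * a + p 1 * b + p 2 * c = 0) (sq : q 0 * a + q 1 * b + q 2 * c = 0) :
    ∃ γ : K, γ ≠ 0 ∧ C γ * a = p 1 * q 2 - p 2 * q 1 ∧ C γ * b = p 2 * q 0 - p 0 * q 2 ∧
      C γ * c = p 0 * q 1 - p 1 * q 0 := by
  have r1 : a * (p 0 * q 1 - p 1 * q 0) = c * (p 1 * q 2 - p 2 * q 1) := by
    linear_combination q 1 * sp - p 1 * sq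
  have r2 : b * (p 0 * q 1 - p 1 * q 0) = c * (p 2 * q 0 - p 0 * q 2) := by
    linear_combination p 0 * sq - q 0 * sp
  obtain ⟨h, hh⟩ : c ∣ p 0 * q 1 - p 1 * q 0 := by
    refine dvd_of_forall_dvd_mul (w := ![a, b, c])
      (fun h hh ↦ hco h (hh 0) (hh 1) (hh 2)) fun i ↦ ?_
    rw [mul_comm]
    fin_cases i
    · exact ⟨_, r1⟩
    · exact ⟨_, r2⟩
    · exact dvd_mul_right _ _
  have ea : h * a = p 1 * q 2 - p 2 * q 1 := by
    refine mul_left_cancel₀ hc0 ?_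
    rw [← r1, hh]; ring
  have eb : h * b = p 2 * q 0 - p 0 * q 2 := by
    refine mul_left_cancel₀ hc0 ?_
    rw [← r2, hh]; ring
  have ec : h * c = p 0 * q 1 - p 1 * q 0 := by rw [hh]; ring
  have h0 : h ≠ 0 := by
    rintro rfl
    rw [zero_mul] at ea eb ec
    have key (i j : Fin 3) : q j * p i = p j * q i := by
      fin_cases i <;> fin_cases j <;> simp only [Fin.zero_eta, Fin.mk_one, Fin.reduceFinMk] <;>
        first
        | exact mul_comm _ _
        | linear_combination ea
        | linear_combination (-1 : Forms K) * ea
        | linear_combination eb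
        | linear_combination (-1 : Forms K) * eb
        | linear_combination ec
        | linear_combination (-1 : Forms K) * ec
    have hq0 : ∀ j, q j = 0 := by
      intro j
      have := (LinearIndependent.pair_iff.mp hli) (q j) (-p j)
        (funext fun i ↦ by simp [key i j])
      exact this.1
    have := hli.ne_zero 1
    exact this (funext hq0)
  have hdeg : h.totalDegree = 0 := by
    have h1 : (h * c).totalDegree = n + l := by
      refine IsHomogeneous.totalDegree ?_ (mul_ne_zero h0 hc0)
      rw [ec]
      exact ((hp 0).mul (hq 1)).sub ((hp 1).mul (hq 0))
    rw [totalDegree_mul_of_isDomain h0 hc0, hc.totalDegree hc0] at h1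
    omega
  rw [totalDegree_eq_zero_iff_eq_C] at hdeg
  refine ⟨h.coeff 0, fun h' ↦ h0 (by rw [hdeg, h', C_0]), ?_⟩
  rw [← hdeg]
  exact ⟨ea, eb, ec⟩

end Forms

/-! ### General position and degenerate cases. -/

section Main

open Polynomial (resultant)

variable {K : Type*} [Field K]

theorem formResultant_add_mul (β : K) {F G : BiForms K} {N : ℕ}
    (hG : (dehomog G).natDegree ≤ N) :
    formResultant (F + inTU (C β) * G) G N N = formResultant F G N N := by
  change resultant (dehomog (F + inTU (C β) * G)) (dehomog G) N N =
    resultant (dehomog F) (dehomog G) N N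
  rw [dehomog_add, dehomog_mul, dehomog_inTU, mul_comm,
    Polynomial.resultant_add_mul_left _ _ _ _ _ (by simp) hG]

theorem crossForm_add_mul (β : K) (a b c : Forms K) :
    crossForm (a + C β * b) c = crossForm a c + inTU (C β) * crossForm b c := by
  simp only [crossForm, inSV, inTU, map_add, map_mul, map_C]
  ring

/-- The dual change of coordinates on syzygies leaves p_φ, hence the Sylvester matrix, untouched. -/
theorem substForm_add_mul (β : K) (a b c : Forms K) (p : Fin 3 → Forms K) :
    substForm (a + C β * b) b c ![p 0, p 1 - C β * p 0, p 2] = substForm a b c p := by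
  simp only [substForm, inSV, inTU, map_add, map_sub, map_mul, map_C, Matrix.cons_val_zero,
    Matrix.cons_val_one, Matrix.cons_val]
  ring

theorem isHomogeneous_change (β : K) {p : Fin 3 → Forms K} {m : ℕ}
    (hp : ∀ i, (p i).IsHomogeneous m) (i : Fin 3) :
    (![p 0, p 1 - C β * p 0, p 2] i).IsHomogeneous m := by
  fin_cases i
  · exact hp 0
  · exact (hp 1).sub ((hp 0).C_mul β)
  · exact hp 2

/-- The resultant of the cross forms is, up to a constant, `c ^ (n - 1)` times the greatest common
divisor of the submaximal minors of the Sylvester matrix of a `μ`-basis. -/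
theorem associated_formResultant [IsAlgClosed K] {m k : ℕ} {a b c : Forms K}
    {p q : Fin 3 → Forms K} {γ : K} {F G : BiForms K} {D : Forms K}
    (ha : a.IsHomogeneous (m + k + 2)) (hb : b.IsHomogeneous (m + k + 2))
    (hc : c.IsHomogeneous (m + k + 2)) (hp : ∀ i, (p i).IsHomogeneous (m + 1))
    (hq : ∀ i, (q i).IsHomogeneous (k + 1)) (hγ : γ ≠ 0) (hc0 : c ≠ 0)
    (hco : ∀ h : Forms K, h ∣ a → h ∣ b → h ∣ c → IsUnit h)
    (sp : p 0 * a + p 1 * b + p 2 * c = 0) (sq : q 0 * a + q 1 * b + q 2 * c = 0)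
    (ea : C γ * a = p 1 * q 2 - p 2 * q 1) (eb : C γ * b = p 2 * q 0 - p 0 * q 2)
    (ec : C γ * c = p 0 * q 1 - p 1 * q 0)
    (hF : crossForm a c = diagForm K * F) (hG : crossForm b c = diagForm K * G)
    (hD : IsGCDOfMinors (formSylvester (substForm a b c p) (substForm a b c q) (m + 1) (k + 1))
      (m + 1 + k) D) :
    Associated (formResultant F G (m + k + 1) (m + k + 1)) (c ^ (m + k + 1) * D) := by
  obtain ⟨β, hβ⟩ := exists_isRelPrime_add_mul hc0 hco
  obtain ⟨P, hP⟩ := diagForm_dvd_substForm hp sp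
  obtain ⟨Q, hQ⟩ := diagForm_dvd_substForm hq sq
  have hPdeg : (dehomog P).natDegree ≤ m :=
    natDegree_dehomog_of_diagForm_mul hP (natDegree_dehomog_substForm_le hp a b c)
  have hQdeg : (dehomog Q).natDegree ≤ k :=
    natDegree_dehomog_of_diagForm_mul hQ (natDegree_dehomog_substForm_le hq a b c)
  have ha' : (a + C β * b).IsHomogeneous (m + k + 2) := ha.add (hb.C_mul β)
  have hF' : crossForm (a + C β * b) c = diagForm K * (F + inTU (C β) * G) := by
    rw [crossForm_add_mul, hF, hG]; ring
  have hP' := (substForm_add_mul β a b c p).trans hP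
  have hQ' := (substForm_add_mul β a b c q).trans hQ
  have ea' : C γ * (a + C β * b) = (![p 0, p 1 - C β * p 0, p 2] : Fin 3 → Forms K) 1 *
      (![q 0, q 1 - C β * q 0, q 2] : Fin 3 → Forms K) 2 -
      (![p 0, p 1 - C β * p 0, p 2] : Fin 3 → Forms K) 2 *
      (![q 0, q 1 - C β * q 0, q 2] : Fin 3 → Forms K) 1 := by
    simp only [Matrix.cons_val_one, Matrix.cons_val]
    linear_combination ea + C β * eb
  have ec' : C γ * c = (![p 0, p 1 - C β * p 0, p 2] : Fin 3 → Forms K) 0 *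
      (![q 0, q 1 - C β * q 0, q 2] : Fin 3 → Forms K) 1 -
      (![p 0, p 1 - C β * p 0, p 2] : Fin 3 → Forms K) 1 *
      (![q 0, q 1 - C β * q 0, q 2] : Fin 3 → Forms K) 0 := by
    simp only [Matrix.cons_val_zero, Matrix.cons_val_one]
    linear_combination ec
  have h₁ := associated_formResultant_of_isRelPrime ha' hb hc (isHomogeneous_change β hp)
    (isHomogeneous_change β hq) hγ hc0 hβ
    (by
      simp only [Matrix.cons_val_zero, Matrix.cons_val_one, Matrix.cons_val]
      linear_combination sp) ea' ec' hF' hG hP' hQ'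
  rw [formResultant_add_mul β (natDegree_dehomog_of_diagForm_mul hG
    (natDegree_dehomog_crossForm_le hb hc))] at h₁
  refine h₁.trans ((Associated.refl _).mul_mul ?_)
  refine associated_resultant_of_isGCDOfMinors (t := X 0) (u := X 1) hPdeg hQdeg isRelPrime_pow_X
    (isUnit_of_dvd_coeff_cofactors ha' hc (by omega) hβ hγ ea' ec' hF' hP' hQ') ?_
  rwa [formSylvester, hP, hQ, dehomog_mul, dehomog_mul, dehomog_diagForm] at hD

/-- Used for c = 0 and μ = 0. For N = 0 it would fail, the empty determinant being 1. -/
theorem formResultant_eq_zero_of_linear_relation {F G : BiForms K} {N : ℕ} (hN : N ≠ 0) {x y : K}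
    (hxy : ¬ (x = 0 ∧ y = 0)) (hF : (dehomog F).natDegree ≤ N) (hG : (dehomog G).natDegree ≤ N)
    (h : inSV (C x) * F + inSV (C y) * G = 0) : formResultant F G N N = 0 := by
  have key (A B : Polynomial (Forms K)) (hB : B.natDegree ≤ N) (x y : K) (hx : x ≠ 0)
      (h : Polynomial.C (C x) * A + Polynomial.C (C y) * B = 0) : resultant A B N N = 0 := by
    have hA : A = 0 + B * Polynomial.C (C (-y / x)) := by
      have h1 : (Polynomial.C (C x) * Polynomial.C (C x⁻¹) : Polynomial (Forms K)) = 1 := by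
        rw [← Polynomial.C_mul, ← C_mul, mul_inv_cancel₀ hx, C_1, Polynomial.C_1]
      rw [div_eq_mul_inv, C_mul, Polynomial.C_mul, C_neg, Polynomial.C_neg]
      linear_combination Polynomial.C (C x⁻¹) * h - A * h1
    rw [hA, Polynomial.resultant_add_mul_left _ _ _ _ _ (by simp) hB,
      Polynomial.resultant_zero_left, zero_pow hN, zero_mul]
  have h' := congrArg dehomog h
  rw [dehomog_add, dehomog_mul, dehomog_mul, inSV, inSV, map_C, map_C, dehomog_C, dehomog_C] at h'
  replace h' : Polynomial.C (C x) * dehomog F + Polynomial.C (C y) * dehomog G = 0 :=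
    h'.trans (map_zero _)
  change resultant (dehomog F) (dehomog G) N N = 0
  rcases eq_or_ne x 0 with hx | hx
  · rw [Polynomial.resultant_comm, key _ _ hF y x (fun hy ↦ hxy ⟨hx, hy⟩) (by rw [add_comm, h']),
      mul_zero]
  · exact key _ _ hG x y hx h'

theorem isGCDOfMinors_eq_zero {R ι : Type*} [CommRing R] {k : ℕ} (hk : k ≠ 0) {D : R}
    (h : IsGCDOfMinors (0 : Matrix ι ι R) k D) : D = 0 := by
  have := Fin.pos_iff_nonempty.mp (Nat.pos_of_ne_zero hk)
  refine zero_dvd_iff.mp (h.2 0 fun r c ↦ ?_)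
  exact dvd_of_eq (Matrix.det_zero (n := Fin k)).symm

theorem formSylvester_zero_left {R : Type*} [CommRing R] (g : MvPolynomial (Fin 2) R) (k : ℕ) :
    formSylvester 0 g 0 k = 0 := by
  have h0 : dehomog (0 : MvPolynomial (Fin 2) R) = 0 := map_zero _
  ext i j
  refine j.addCases (fun j ↦ j.elim0) fun j ↦ ?_
  simp only [formSylvester, Polynomial.sylvester, Matrix.of_apply, Fin.addCases_right, h0,
    Polynomial.coeff_zero, ite_self, Matrix.zero_apply]

theorem mem_syzygies_iff {a b c : Forms K} {p : Fin 3 → Forms K} :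
    p ∈ syzygies a b c ↔ p 0 * a + p 1 * b + p 2 * c = 0 := by
  simp [syzygies, Fintype.linearCombination_apply, Fin.sum_univ_three]

end Main

end DResultant

end

theorem mainTheorem3 {K : Type*} [Field K] [IsAlgClosed K] [CharZero K]
    (n : ℕ) (hn : 3 ≤ n) (a b c : DResultant.Forms K)
    (hφ : DResultant.IsProperParam n a b c)
    (μ : ℕ) (p q : Fin 3 → DResultant.Forms K) (hpq : DResultant.IsMuBasis n μ a b c p q)
    (d : ℕ → DResultant.Forms K) (hd : DResultant.IsSingularFactors n μ a b c p q d) :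
    ∃ F₁ G₁ : DResultant.BiForms K,
      DResultant.crossForm a c = DResultant.diagForm K * F₁ ∧
      DResultant.crossForm b c = DResultant.diagForm K * G₁ ∧
      ∃ γ : K, γ ≠ 0 ∧
        DResultant.formResultant F₁ G₁ (n - 1) (n - 1) =
          MvPolynomial.C γ * (c ^ (n - 1) * ∏ k ∈ Finset.Icc 2 n, d k ^ (k - 1)) := by
  open DResultant in
  obtain ⟨ha, hb, hc, hco, -⟩ := hφ
  obtain ⟨F, hF⟩ := diagForm_dvd_crossForm ha hc
  obtain ⟨G, hG⟩ := diagForm_dvd_crossForm hb hc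
  refine ⟨F, G, hF, hG, ?_⟩
  have hFdeg : (dehomog F).natDegree ≤ n - 1 := natDegree_dehomog_of_diagForm_mul hF
    ((natDegree_dehomog_crossForm_le ha hc).trans (by omega))
  have hGdeg : (dehomog G).natDegree ≤ n - 1 := natDegree_dehomog_of_diagForm_mul hG
    ((natDegree_dehomog_crossForm_le hb hc).trans (by omega))
  have sp : p 0 * a + p 1 * b + p 2 * c = 0 := mem_syzygies_iff.mp
    (hpq.span_eq ▸ Submodule.subset_span (Set.mem_insert _ _))
  have sq : q 0 * a + q 1 * b + q 2 * c = 0 := mem_syzygies_iff.mp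
    (hpq.span_eq ▸ Submodule.subset_span (Set.mem_insert_of_mem _ rfl))
  -- The index i = 2 is the one for the (n-1)-minors.
  have hD := hd.isGCD 2 (Finset.mem_Icc.mpr ⟨one_le_two, by omega⟩)
  have hprod : ∏ j ∈ Finset.Icc 2 n, d j ^ (j - 2 + 1) = ∏ k ∈ Finset.Icc 2 n, d k ^ (k - 1) :=
    Finset.prod_congr rfl fun j hj ↦ by
      rw [show j - 2 + 1 = j - 1 by have := (Finset.mem_Icc.mp hj).1; omega]
  rw [hprod] at hD
  generalize ∏ k ∈ Finset.Icc 2 n, d k ^ (k - 1) = D at hD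
  have hμ := hpq.two_mul_le
  rcases eq_or_ne c 0 with rfl | hc0
  · refine ⟨1, one_ne_zero, ?_⟩
    have h0 (x : Forms K) (H : BiForms K) (h : crossForm x 0 = diagForm K * H) : H = 0 := by
      have : crossForm x 0 = 0 := by simp [crossForm, inSV, inTU]
      exact (mul_eq_zero.mp (h.symm.trans this)).resolve_left diagForm_ne_zero
    rw [zero_pow (by omega), zero_mul, mul_zero]
    refine formResultant_eq_zero_of_linear_relation (x := 1) (y := 1) (by omega) (by simp) hFdeg
      hGdeg ?_
    simp only [h0 a F hF, h0 b G hG, mul_zero, add_zero]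
  obtain ⟨k, hk⟩ : ∃ k, n - μ = k + 1 := ⟨n - μ - 1, by omega⟩
  rcases μ with _ | m
  -- If μ = 0, `p` is constant and p_φ is the syzygy itself in (t,u), hence zero. The Sylvester
  -- matrix and its gcd vanish, and the left side vanishes since p₁ F + p₂ G = 0 with constant
  -- coefficients.
  · have hconst (i : Fin 3) : p i = MvPolynomial.C ((p i).coeff 0) :=
      MvPolynomial.totalDegree_eq_zero_iff_eq_C.mp
        (Nat.le_zero.mp (hpq.homogeneous_p i).totalDegree_le)
    have hP : substForm a b c p = 0 := by
      have h (i : Fin 3) : inSV (p i) = inTU (p i) := by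
        rw [hconst i, inSV, MvPolynomial.map_C]; rfl
      rw [substForm, h, h, h, inTU, inTU, inTU, inTU, inTU, inTU, ← MvPolynomial.C_mul,
        ← MvPolynomial.C_mul, ← MvPolynomial.C_mul, ← MvPolynomial.C_add, ← MvPolynomial.C_add, sp,
        MvPolynomial.C_0]
    refine ⟨1, one_ne_zero, ?_⟩
    rw [hP, formSylvester_zero_left] at hD
    rw [isGCDOfMinors_eq_zero (by omega) hD, mul_zero, mul_zero]
    refine formResultant_eq_zero_of_linear_relation (x := (p 0).coeff 0) (y := (p 1).coeff 0)
      (by omega) ?_ hFdeg hGdeg ?_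
    · rintro ⟨h0, h1⟩
      have hp0 : p 0 = 0 := by rw [hconst 0, h0, MvPolynomial.C_0]
      have hp1 : p 1 = 0 := by rw [hconst 1, h1, MvPolynomial.C_0]
      have hp2 : p 2 = 0 := by
        rw [hp0, hp1, zero_mul, zero_mul, zero_add, zero_add] at sp
        exact (mul_eq_zero.mp sp).resolve_right hc0
      refine hpq.linearIndependent.ne_zero 0 (funext fun i ↦ ?_)
      fin_cases i
      · exact hp0
      · exact hp1
      · exact hp2
    · have := cofactor_relation_left sp hF hG (hP.trans (mul_zero _).symm)
      rw [mul_zero, zero_eq_neg] at this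
      rwa [← hconst, ← hconst]
  · obtain rfl : n = m + k + 2 := by omega
    have hq := hpq.homogeneous_q
    rw [hk] at hD hq
    rw [show m + k + 2 + 1 - 2 = m + 1 + k by omega] at hD
    obtain ⟨γ, hγ, ea, eb, ec⟩ := exists_cross_eq (n := m + 1) (l := k + 1)
      (by rwa [show m + 1 + (k + 1) = m + k + 2 by omega]) hpq.homogeneous_p hq hc0 hco
      hpq.linearIndependent sp sq
    have := associated_formResultant ha hb hc hpq.homogeneous_p hq hγ hc0 hco sp sq ea eb ec hF hG hD
    obtain ⟨u, hu⟩ := this.symm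
    obtain ⟨r, hr, hr'⟩ := MvPolynomial.isUnit_iff_eq_C_of_isReduced.mp u.isUnit
    refine ⟨r, hr.ne_zero, ?_⟩
    rw [← hr', mul_comm]
    exact hu.symm
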